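/- Let $H$ be a complex Hilbert space and let $E$ be a linear operator in $H$, defined on a linear subspace $\operatorname{dom}(E)\subseteq H$ ($E$ is not assumed to be closed or densely defined). Let $\rho(E)$ be the set of $\lambda\in\mathbb C$ such that $\lambda-E:\operatorname{dom}(E)\to H$ is bijective with bounded inverse, and put $\sigma(E)=\mathbb C\setminus\rho(E)$. A $C_0$-semigroup $(T(t))_{t\ge0}$ on $H$ is called similar to an isometric $C_0$-semigroup if there are a bounded, boundedly invertible operator $R$ on $H$ and a $C_0$-semigroup $(S(t))_{t\ge0}$ on $H$ consisting of isometries such that $RT(t)R^{-1}=S(t)$ for all $t\ge0$. All means below take values in $[0,\infty]$. Then the following are equivalent. 1. $E$ generates a $C_0$-semigroup $(T(t))_{t\ge0}$ on $H$ that is similar to an isometric $C_0$-semigroup. 2. $E$ generates a $C_0$-semigroup $(T(t))_{t\ge0}$ on $H$, and there exist a Hilbert space $K$ and a densely defined linear operator $C:\operatorname{dom}(C)\subseteq H\to K$ such that $T(t)\operatorname{dom}(C)\subseteq\operatorname{dom}(C)$ for all $t\ge0$; for every $h\in\operatorname{dom}(C)$ the map $[0,\infty)\to K$, $t\mapsto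 CT(t)h$, is Bochner measurable; and, for some $\alpha,\beta>0$, either $$\alpha\|h\|^2\le\limsup_{t\to\infty}\frac1t\int_0^t\|CT(s)h\|_K^2\,ds\le\beta\|h\|^2\quad\text{for all }h\in\operatorname{dom}(C),$$ or $$\alpha\|h\|^2\le\liminf_{t\to\infty}\frac1t\int_0^t\|CT(s)h\|_K^2\,ds\le\beta\|h\|^2\quad\text{for all }h\in\operatorname{dom}(C).$$ 3. $\sigma(E)\subseteq\{z\in\mathbb C:\operatorname{Re}z\le0\}$, and there exist a Hilbert space $K$ and a densely defined linear operator $C:\operatorname{dom}(C)\subseteq H\to K$ such that (a) $\operatorname{dom}(E)\subseteq\operatorname{dom}(C)$; (b) for all $\varepsilon>0$ and $h\in H$ the map $\mathbb R\to K$, $\xi\mapsto C(\varepsilon+i\xi-E)^{-1}h$, is Bochner measurable; (c) there exist $\alpha,\beta>0$ such that for all $h\in H$ $$\limsup_{\varepsilon\to0^+}\varepsilon\int_{-\infty}^\infty\|C(\varepsilon+i\xi-E)^{-1}h\|_K^2\,d\xi\le\beta\|h\|^2,\qquad \liminf_{\varepsilon\to0^+}\varepsilon\int_{-\infty}^\infty\|C(\varepsilon+i\xi-E)^{-1}h\|_K^2\,d\xi\ge\alpha\|h\|^2.$$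 -/

import Mathlib

open Filter MeasureTheory Topology

universe u

section SemigroupDefs

variable {H : Type u} [NormedAddCommGroup H] [InnerProductSpace ℂ H]

/-- `T` is a `C₀`-semigroup `(T(t))_{t ≥ 0}` of bounded operators on `H`.
The values of `T` at negative times are irrelevant. -/
structure IsC0Semigroup (T : ℝ → H →L[ℂ] H) : Prop where
  map_zero : T 0 = ContinuousLinearMap.id ℂ H
  map_add : ∀ s t : ℝ, 0 ≤ s → 0 ≤ t → T (s + t) = (T s).comp (T t)
  strongly_continuous : ∀ h : H, Tendsto (fun t : ℝ => T t h) (𝓝[>] 0) (𝓝 h)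

/-- The linear operator `E` is the generator of `T`: its graph consists of the pairs `(x, y)`
with `(T(t)x - x)/t → y` as `t → 0+`. -/
def IsGeneratorOf (E : H →ₗ.[ℂ] H) (T : ℝ → H →L[ℂ] H) : Prop :=
  ∀ x y : H, (x, y) ∈ E.graph ↔
    Tendsto (fun t : ℝ => ((t : ℂ)⁻¹) • (T t x - x)) (𝓝[>] 0) (𝓝 y)

/-- `T` is similar to an isometric `C₀`-semigroup: `R T(t) R⁻¹ = S(t)` for all `t ≥ 0`, with `R`
bounded and boundedly invertible and `S` a `C₀`-semigroup of isometries on `H`. -/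
def IsSimilarToIsometricSemigroup (T : ℝ → H →L[ℂ] H) : Prop :=
  ∃ (S : ℝ → H →L[ℂ] H) (R : H ≃L[ℂ] H), IsC0Semigroup S ∧
    (∀ t : ℝ, 0 ≤ t → ∀ h : H, ‖S t h‖ = ‖h‖) ∧
    ∀ t : ℝ, 0 ≤ t → ∀ h : H, R (T t (R.symm h)) = S t h

/-- The bounded operator `R` on `H` is the two-sided inverse `(z - E)⁻¹` of
`z - E : dom E → H`. -/
structure IsResolventAt (E : H →ₗ.[ℂ] H) (z : ℂ) (R : H →L[ℂ] H) : Prop where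
  right_inv : ∀ y : H, ∃ hy : R y ∈ E.domain, z • R y - E ⟨R y, hy⟩ = y
  left_inv : ∀ x : E.domain, R (z • (x : H) - E x) = x

/-- The resolvent set of a (not necessarily closed or densely defined) operator. -/
def operatorResolventSet (E : H →ₗ.[ℂ] H) : Set ℂ :=
  {z | ∃ R : H →L[ℂ] H, IsResolventAt E z R}

/-- The spectrum of a (not necessarily closed or densely defined) operator. -/
def operatorSpectrum (E : H →ₗ.[ℂ] H) : Set ℂ :=
  (operatorResolventSet E)ᶜ

open Classical in
/-- `(z - E)⁻¹` for `z` in the resolvent set (and `0` otherwise). -/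
noncomputable def operatorResolvent (E : H →ₗ.[ℂ] H) (z : ℂ) : H →L[ℂ] H :=
  if hz : ∃ R : H →L[ℂ] H, IsResolventAt E z R then hz.choose else 0

theorem isResolventAt_operatorResolvent {E : H →ₗ.[ℂ] H} {z : ℂ}
    (hz : z ∈ operatorResolventSet E) : IsResolventAt E z (operatorResolvent E z) := by
  have h : ∃ R : H →L[ℂ] H, IsResolventAt E z R := hz
  rw [operatorResolvent, dif_pos h]
  exact h.choose_spec

theorem IsResolventAt.unique {E : H →ₗ.[ℂ] H} {z : ℂ} {R R' : H →L[ℂ] H}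
    (hR : IsResolventAt E z R) (hR' : IsResolventAt E z R') : R = R' := by
  ext y
  obtain ⟨hy, e⟩ := hR'.right_inv y
  have := hR.left_inv ⟨R' y, hy⟩
  rwa [e] at this

variable {K : Type u} [NormedAddCommGroup K] [InnerProductSpace ℂ K]

open Classical in
/-- The value `C x` for `x ∈ dom C` (and `0` otherwise). -/
noncomputable def applyOp (C : H →ₗ.[ℂ] K) (x : H) : K :=
  if hx : x ∈ C.domain then C ⟨x, hx⟩ else 0

/-- The Cesàro mean `(1/t) ∫_0^t ‖C T(s) h‖² ds` (possibly `∞`), for `t > 0`. -/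
noncomputable def cesaroMean (C : H →ₗ.[ℂ] K) (T : ℝ → H →L[ℂ] H) (h : H) (t : ℝ) : ENNReal :=
  ENNReal.ofReal (1 / t) * ∫⁻ s in Set.Icc 0 t, ‖applyOp C (T s h)‖ₑ ^ 2

/-- The resolvent mean `ε ∫_ℝ ‖C (ε + iξ - E)⁻¹ h‖² dξ` (possibly `∞`), for `ε > 0`. -/
noncomputable def resolventMean (C : H →ₗ.[ℂ] K) (E : H →ₗ.[ℂ] H) (h : H) (ε : ℝ) : ENNReal :=
  ENNReal.ofReal ε *
    ∫⁻ ξ : ℝ, ‖applyOp C (operatorResolvent E ((ε : ℂ) + (ξ : ℂ) * Complex.I) h)‖ₑ ^ 2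

/-- The domain of `C` is dense and invariant under `T(t)`, `t ≥ 0`, and the weighted orbits
`t ↦ C T(t) h`, `t ≥ 0`, `h ∈ dom C`, are Bochner measurable. -/
structure IsSemigroupWeight (C : H →ₗ.[ℂ] K) (T : ℝ → H →L[ℂ] H) : Prop where
  dense : Dense (C.domain : Set H)
  invariant : ∀ t : ℝ, 0 ≤ t → ∀ h ∈ C.domain, T t h ∈ C.domain
  measurable : ∀ h ∈ C.domain,
    AEStronglyMeasurable (fun t : ℝ => applyOp C (T t h)) (volume.restrict (Set.Ici 0))

/-- The domain of `C` is dense and contains `dom E`, and the maps `ξ ↦ C (ε + iξ - E)⁻¹ h`,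
`ε > 0`, `h ∈ H`, are Bochner measurable on `ℝ`. -/
structure IsResolventWeight (C : H →ₗ.[ℂ] K) (E : H →ₗ.[ℂ] H) : Prop where
  dense : Dense (C.domain : Set H)
  domain_le : E.domain ≤ C.domain
  measurable : ∀ ε : ℝ, 0 < ε → ∀ h : H,
    AEStronglyMeasurable
      (fun ξ : ℝ => applyOp C (operatorResolvent E ((ε : ℂ) + (ξ : ℂ) * Complex.I) h)) volume

end SemigroupDefs

/-!
Condition 1 holds exactly when `T` is isometric for an equivalent inner product `⟨Q x, y⟩`, since
`Q^{1/2}` then conjugates `T` into isometries. Such a `Q` is a limit along an ultrafilter of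
bounded positive sesquilinear forms.

From condition 2: the Cesàro means of `‖C T(s) h‖²` do not change when `h` is replaced by `T(τ) h`,
so their two-sided bound makes `T` bounded above and below. Hence the forms
`(1/t) ∫₀ᵗ ⟨T(s) x, T(s) y⟩ ds` are uniformly bounded and coercive, and any limit of them as
`t → ∞` is `T`-invariant.

From condition 3: the limit as `ε → 0⁺` of `ε ∫ ⟨C R(ε + iξ) x, C R(ε + iξ) y⟩ dξ` makes `E` skew,
because the resolvent identity writes the defect as terms that vanish with `ε`. Skewness makes
`r R(r)` a contraction for the new norm, so its powers are uniformly bounded and the Hille–Yosida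
theorem applies. Conversely, by Plancherel, for `C = id` these means are `π` times Abel means of
`‖T(t) h‖²`.
-/

section Exponential

open NormedSpace

section BanachAlgebra

variable {𝔸 : Type*} [NormedRing 𝔸] [NormedAlgebra ℝ 𝔸] [CompleteSpace 𝔸]

theorem exp_add_eq_mul_of_commute {a b : 𝔸} (h : Commute a b) : exp (a + b) = exp a * exp b :=
  letI : NormedAlgebra ℚ 𝔸 := NormedAlgebra.restrictScalars ℚ ℝ _
  exp_add_of_commute h

theorem exp_add_smul (a : 𝔸) (s t : ℝ) : exp ((s + t) • a) = exp (s • a) * exp (t • a) := by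
  rw [add_smul]
  exact exp_add_eq_mul_of_commute (((Commute.refl a).smul_left s).smul_right t)

theorem norm_exp_smul_le_of_norm_pow_le {b : 𝔸} {M : ℝ} (hb : ∀ k : ℕ, ‖b ^ k‖ ≤ M) {t : ℝ}
    (ht : 0 ≤ t) : ‖exp (t • b)‖ ≤ Real.exp t * M := by
  have hexp : HasSum (fun n : ℕ => ((n.factorial : ℝ)⁻¹ * t ^ n) * M) (Real.exp t * M) := by
    rw [Real.exp_eq_exp_ℝ]
    exact (exp_series_hasSum_exp' (𝕂 := ℝ) t).mul_right M
  refine (exp_series_hasSum_exp' (𝕂 := ℝ) (t • b)).norm_le_of_bounded hexp fun n => ?_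
  have hn : 0 ≤ (n.factorial : ℝ)⁻¹ * t ^ n := by positivity
  rw [smul_pow, smul_smul, norm_smul, Real.norm_of_nonneg hn]
  exact mul_le_mul_of_nonneg_left (hb n) hn

theorem norm_exp_smul_sub_one_le {b : 𝔸} {M : ℝ} (hb : ∀ k : ℕ, ‖b ^ k‖ ≤ M) {t : ℝ}
    (ht : 0 ≤ t) : ‖exp (t • (b - 1))‖ ≤ M := by
  have hone : exp ((-t) • (1 : 𝔸)) = Real.exp (-t) • 1 := by
    rw [← Algebra.algebraMap_eq_smul_one, ← Algebra.algebraMap_eq_smul_one,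
      Real.exp_eq_exp_ℝ, algebraMap_exp_comm]
  have hsplit : t • (b - 1) = t • b + (-t) • 1 := by module
  rw [hsplit, exp_add_eq_mul_of_commute ((Commute.one_right _).smul_right _), hone,
    mul_smul_comm, mul_one, norm_smul, Real.norm_of_nonneg (Real.exp_nonneg _)]
  calc Real.exp (-t) * ‖exp (t • b)‖ ≤ Real.exp (-t) * (Real.exp t * M) := by
        gcongr; exact norm_exp_smul_le_of_norm_pow_le hb ht
    _ = M := by rw [← mul_assoc, ← Real.exp_add]; simp

theorem exp_smul_sub_mul_exp_smul {a b : 𝔸} (h : Commute a b) (s t : ℝ) :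
    exp (s • (a - b)) * exp (t • b) = exp (s • a) * exp ((t - s) • b) := by
  rw [← exp_add_eq_mul_of_commute, ← exp_add_eq_mul_of_commute ((h.smul_left _).smul_right _)]
  · congr 1; module
  · exact ((h.sub_left (Commute.refl b)).smul_left s).smul_right t

end BanachAlgebra

section Operator

variable {X : Type*} [NormedAddCommGroup X] [NormedSpace ℂ X] [CompleteSpace X]

theorem hasDerivAt_exp_smul_apply (A : X →L[ℂ] X) (x : X) (t : ℝ) :
    HasDerivAt (fun s : ℝ => exp (s • A) x) (exp (t • A) (A x)) t := by
  simpa [Function.comp_def] using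
    ((ContinuousLinearMap.apply ℂ X x).restrictScalars ℝ).hasFDerivAt.comp_hasDerivAt t
      (hasDerivAt_exp_smul_const A t)

theorem continuous_exp_smul_apply (A : X →L[ℂ] X) (x : X) :
    Continuous fun s : ℝ => exp (s • A) x :=
  continuous_iff_continuousAt.2 fun s => (hasDerivAt_exp_smul_apply A x s).continuousAt

theorem exp_smul_apply_sub_eq_integral (A : X →L[ℂ] X) (x : X) (t : ℝ) :
    exp (t • A) x - x = ∫ s in (0 : ℝ)..t, exp (s • A) (A x) := by
  rw [intervalIntegral.integral_eq_sub_of_hasDerivAt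
    (fun s _ => hasDerivAt_exp_smul_apply A x s)
    ((continuous_exp_smul_apply A (A x)).intervalIntegrable 0 t)]
  simp

theorem norm_exp_smul_sub_exp_smul_apply_le {A B : X →L[ℂ] X} (hAB : Commute A B) {M : ℝ}
    (hA : ∀ t : ℝ, 0 ≤ t → ‖exp (t • A)‖ ≤ M) (hB : ∀ t : ℝ, 0 ≤ t → ‖exp (t • B)‖ ≤ M)
    {t : ℝ} (ht : 0 ≤ t) (x : X) :
    ‖exp (t • A) x - exp (t • B) x‖ ≤ M * (M * ‖A x - B x‖) * t := by
  have hsplit : ∀ s y, exp (s • (A - B)) (exp (t • B) y) = exp (s • A) (exp ((t - s) • B) y) :=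
    fun s y => DFunLike.congr_fun (exp_smul_sub_mul_exp_smul hAB s t) y
  have hcomm : ∀ y, (A - B) (exp (t • B) y) = exp (t • B) ((A - B) y) := fun y =>
    DFunLike.congr_fun (((hAB.sub_left (Commute.refl B)).smul_right t).exp_right).eq y
  have hderiv_le : ∀ s ∈ Set.Ico 0 t,
      ‖exp (s • (A - B)) ((A - B) (exp (t • B) x))‖ ≤ M * (M * ‖A x - B x‖) := by
    intro s hs
    rw [hcomm, hsplit]
    exact (exp (s • A)).le_of_opNorm_le_of_le (hA s hs.1)
      ((exp ((t - s) • B)).le_of_opNorm_le (hB _ (sub_nonneg.2 hs.2.le)) _)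
  simpa [hsplit] using norm_image_sub_le_of_norm_deriv_le_segment' (a := 0) (b := t)
    (fun s _ => (hasDerivAt_exp_smul_apply (A - B) (exp (t • B) x) s).hasDerivWithinAt)
    hderiv_le t ⟨ht, le_rfl⟩

end Operator

end Exponential

section UniformlyBounded

variable {ι X Y : Type*} [NormedAddCommGroup X] [NormedSpace ℂ X] [NormedAddCommGroup Y]
  [NormedSpace ℂ Y] {l : Filter ι} {F : ι → X →L[ℂ] Y} {M : ℝ} {s : Set X}

theorem equicontinuous_of_norm_le (hF : ∀ i, ‖F i‖ ≤ M) : Equicontinuous fun i x => F i x :=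
  (LipschitzWith.uniformEquicontinuous _ M.toNNReal fun i =>
    (F i).lipschitz.weaken (NNReal.le_toNNReal_of_coe_le (hF i))).equicontinuous

theorem tendsto_apply_of_dense (hF : ∀ i, ‖F i‖ ≤ M) (hs : Dense s) {G : X →L[ℂ] Y}
    (h : ∀ x ∈ s, Tendsto (fun i => F i x) l (𝓝 (G x))) (x : X) :
    Tendsto (fun i => F i x) l (𝓝 (G x)) :=
  (((equicontinuous_of_norm_le hF).isClosed_setOfPred_tendsto G.continuous).closure_subset_iff.2
    h) (hs x)

theorem cauchySeq_apply_of_dense {F : ℕ → X →L[ℂ] Y} (hF : ∀ n, ‖F n‖ ≤ M) (hs : Dense s)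
    (h : ∀ x ∈ s, CauchySeq fun n => F n x) (x : X) : CauchySeq fun n => F n x := by
  have hdiff : ∀ p : ℕ × ℕ, ‖F p.1 - F p.2‖ ≤ M + M := fun p =>
    (norm_sub_le _ _).trans (add_le_add (hF _) (hF _))
  have hzero := tendsto_apply_of_dense (l := atTop) (G := 0) hdiff hs fun x hx =>
    tendsto_zero_iff_norm_tendsto_zero.2 <| by
      simpa [dist_eq_norm] using cauchySeq_iff_tendsto_dist_atTop_0.1 (h x hx)
  exact cauchySeq_iff_tendsto_dist_atTop_0.2 <| by
    simpa [dist_eq_norm] using (hzero x).norm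

theorem tendsto_apply_apply (hF : ∀ i, ‖F i‖ ≤ M) {G : X →L[ℂ] Y} {u : ι → X} {v : X}
    (hG : Tendsto (fun i => F i v) l (𝓝 (G v))) (hu : Tendsto u l (𝓝 v)) :
    Tendsto (fun i => F i (u i)) l (𝓝 (G v)) := by
  have hzero : Tendsto (fun i => F i (u i - v)) l (𝓝 0) :=
    squeeze_zero_norm (fun i => (F i).le_of_opNorm_le (hF i) _) <| by
      simpa using (hu.sub_const v).norm.const_mul M
  simpa using hzero.add hG

end UniformlyBounded

section BoundedSemigroup

variable {H : Type u} [NormedAddCommGroup H] [InnerProductSpace ℂ H]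
variable {T : ℝ → H →L[ℂ] H} {M : ℝ}

namespace IsC0Semigroup

theorem apply_zero (hT : IsC0Semigroup T) (h : H) : T 0 h = h := by
  rw [hT.map_zero, ContinuousLinearMap.id_apply]

theorem apply_add (hT : IsC0Semigroup T) {s t : ℝ} (hs : 0 ≤ s) (ht : 0 ≤ t) (h : H) :
    T (s + t) h = T s (T t h) := by
  rw [hT.map_add s t hs ht, ContinuousLinearMap.comp_apply]

theorem tendsto_abs (hT : IsC0Semigroup T) (h : H) :
    Tendsto (fun r : ℝ => T |r| h) (𝓝 0) (𝓝 h) := by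
  have hright : Tendsto (fun t : ℝ => T t h) (𝓝[≥] 0) (𝓝 h) := by
    have hcont : ContinuousWithinAt (fun t : ℝ => T t h) (Set.Ioi 0) 0 := by
      simpa [ContinuousWithinAt, hT.apply_zero] using hT.strongly_continuous h
    simpa [ContinuousWithinAt, hT.apply_zero] using continuousWithinAt_Ioi_iff_Ici.1 hcont
  have habs : Tendsto (fun r : ℝ => |r|) (𝓝 0) (𝓝[≥] 0) :=
    tendsto_nhdsWithin_iff.2 ⟨by simpa using (continuous_abs.tendsto (0 : ℝ)),
      Eventually.of_forall abs_nonneg⟩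
  exact hright.comp habs

theorem tendsto_smul_sub_iff_hasDerivWithinAt (hT : IsC0Semigroup T) {x y : H} :
    Tendsto (fun t : ℝ => ((t : ℂ)⁻¹) • (T t x - x)) (𝓝[>] 0) (𝓝 y) ↔
      HasDerivWithinAt (fun t => T t x) y (Set.Ici 0) 0 := by
  rw [← hasDerivWithinAt_Ioi_iff_Ici, hasDerivWithinAt_iff_tendsto_slope' (by simp)]
  simp only [slope_fun_def, vsub_eq_sub, sub_zero, hT.apply_zero, ← Complex.ofReal_inv,
    Complex.coe_smul]

theorem hasDerivWithinAt_orbit (hT : IsC0Semigroup T) {x y : H}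
    (hxy : HasDerivWithinAt (fun t => T t x) y (Set.Ici 0) 0) {t : ℝ} (ht : 0 ≤ t) :
    HasDerivWithinAt (fun s => T s x) (T t y) (Set.Ici t) t := by
  have hshift : HasDerivWithinAt (fun s : ℝ => s - t) 1 (Set.Ici t) t :=
    ((hasDerivAt_id t).sub_const t).hasDerivWithinAt
  have hcomp : HasDerivWithinAt (fun s => T t (T (s - t) x)) (T t y) (Set.Ici t) t := by
    have hstart : HasDerivWithinAt (fun r => T t (T r x)) (T t y) (Set.Ici 0) (t - t) := by
      rw [sub_self]
      exact ((T t).restrictScalars ℝ).hasFDerivAt.comp_hasDerivWithinAt 0 hxy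
    simpa [Function.comp_def] using
      hstart.scomp (h := (· - t)) t hshift fun s hs => Set.mem_Ici.2 (sub_nonneg.2 hs)
  refine hcomp.congr (fun s hs => ?_) ?_
  · rw [← hT.apply_add ht (sub_nonneg.2 hs), add_sub_cancel]
  · rw [← hT.apply_add ht (sub_self t).ge, add_sub_cancel]

end IsC0Semigroup

/-- A `C₀`-semigroup on `[0, ∞)` whose operators are all bounded by `M` in norm. -/
structure IsBoundedC0Semigroup (T : ℝ → H →L[ℂ] H) (M : ℝ) : Prop extends IsC0Semigroup T where
  norm_le : ∀ t : ℝ, 0 ≤ t → ‖T t‖ ≤ M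

namespace IsBoundedC0Semigroup

theorem bound_nonneg (hT : IsBoundedC0Semigroup T M) : 0 ≤ M :=
  (norm_nonneg (T 0)).trans (hT.norm_le 0 le_rfl)

theorem norm_apply_le (hT : IsBoundedC0Semigroup T M) {t : ℝ} (ht : 0 ≤ t) (h : H) :
    ‖T t h‖ ≤ M * ‖h‖ :=
  (T t).le_of_opNorm_le (hT.norm_le t ht) h

theorem norm_apply_sub_apply_le (hT : IsBoundedC0Semigroup T M) {s t : ℝ} (hs : 0 ≤ s)
    (ht : 0 ≤ t) (h : H) : ‖T s h - T t h‖ ≤ M * ‖T |s - t| h - h‖ := by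
  wlog hst : t ≤ s generalizing s t
  · rw [norm_sub_rev, abs_sub_comm]
    exact this ht hs (le_of_not_ge hst)
  have hsplit : T s h = T t (T |s - t| h) := by
    rw [← hT.apply_add ht (abs_nonneg _), abs_of_nonneg (sub_nonneg.2 hst), add_sub_cancel]
  rw [hsplit, ← map_sub]
  exact hT.norm_apply_le ht _

theorem continuous_abs_orbit (hT : IsBoundedC0Semigroup T M) (h : H) :
    Continuous fun t : ℝ => T |t| h := by
  refine continuous_iff_continuousAt.2 fun t => tendsto_iff_norm_sub_tendsto_zero.2 ?_
  have hgap : Tendsto (fun s : ℝ => |s| - |t|) (𝓝 t) (𝓝 0) := by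
    simpa using (continuous_abs.tendsto t).sub_const |t|
  refine squeeze_zero (fun _ => norm_nonneg _)
    (fun s => hT.norm_apply_sub_apply_le (abs_nonneg s) (abs_nonneg t) h) ?_
  simpa [Function.comp_def] using
    ((((hT.tendsto_abs h).comp hgap).sub_const h).norm.const_mul M)

theorem continuousOn_orbit (hT : IsBoundedC0Semigroup T M) (h : H) :
    ContinuousOn (fun t => T t h) (Set.Ici 0) :=
  (hT.continuous_abs_orbit h).continuousOn.congr fun t ht => by
    simp only [abs_of_nonneg (Set.mem_Ici.1 ht)]

theorem cexp_smul_apply_eq_of_eigenvector (hT : IsBoundedC0Semigroup T M) {z : ℂ} {x : H}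
    (hx : HasDerivWithinAt (fun t => T t x) (z • x) (Set.Ici 0) 0) {t : ℝ} (ht : 0 ≤ t) :
    Complex.exp (-z * t) • T t x = x := by
  have hexp : ∀ s : ℝ,
      HasDerivAt (fun s : ℝ => Complex.exp (-z * s)) (Complex.exp (-z * s) * -z) s := fun s => by
    simpa using ((Complex.ofRealCLM.hasDerivAt (x := s)).const_mul (-z)).cexp
  have hcont : ContinuousOn (fun s : ℝ => Complex.exp (-z * s) • T s x) (Set.Icc 0 t) :=
    (Continuous.continuousOn (by fun_prop)).smul
      ((hT.continuousOn_orbit x).mono Set.Icc_subset_Ici_self)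
  have hderiv : ∀ s ∈ Set.Ico 0 t, HasDerivWithinAt
      (fun s : ℝ => Complex.exp (-z * s) • T s x) 0 (Set.Ici s) s := fun s hs => by
    convert (hexp s).hasDerivWithinAt.fun_smul (hT.hasDerivWithinAt_orbit hx hs.1) using 1
    rw [map_smul]
    module
  simpa [hT.apply_zero] using constant_of_has_deriv_right_zero hcont hderiv t ⟨ht, le_rfl⟩

theorem eq_zero_of_eigenvector (hT : IsBoundedC0Semigroup T M) {z : ℂ} (hz : 0 < z.re) {x : H}
    (hx : HasDerivWithinAt (fun t => T t x) (z • x) (Set.Ici 0) 0) : x = 0 := by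
  have hle : ∀ t : ℝ, 0 ≤ t → ‖x‖ ≤ Real.exp (-z.re * t) * (M * ‖x‖) := fun t ht =>
    calc ‖x‖ = ‖Complex.exp (-z * t)‖ * ‖T t x‖ := by
          rw [← norm_smul, hT.cexp_smul_apply_eq_of_eigenvector hx ht]
      _ = Real.exp (-z.re * t) * ‖T t x‖ := by simp [Complex.norm_exp]
      _ ≤ Real.exp (-z.re * t) * (M * ‖x‖) := by gcongr; exact hT.norm_apply_le ht x
  have hlim : Tendsto (fun t : ℝ => Real.exp (-z.re * t) * (M * ‖x‖)) atTop (𝓝 0) := by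
    simpa using ((Real.tendsto_exp_atBot.comp
      (tendsto_id.const_mul_atTop_of_neg (neg_lt_zero.2 hz))).mul_const (M * ‖x‖))
  exact norm_le_zero_iff.1 (ge_of_tendsto hlim ((eventually_ge_atTop 0).mono hle))

end IsBoundedC0Semigroup

end BoundedSemigroup

section Resolvent

variable {H : Type u} [NormedAddCommGroup H] [InnerProductSpace ℂ H] {E : H →ₗ.[ℂ] H}

namespace IsResolventAt

variable {z w : ℂ} {R S : H →L[ℂ] H}

theorem mem_domain (hR : IsResolventAt E z R) (y : H) : R y ∈ E.domain :=
  (hR.right_inv y).1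

theorem apply_eq (hR : IsResolventAt E z R) (y : H) :
    E ⟨R y, hR.mem_domain y⟩ = z • R y - y := by
  rw [eq_sub_iff_add_eq, ← eq_sub_iff_add_eq']
  exact (hR.right_inv y).2.symm

theorem apply_map (hR : IsResolventAt E z R) (x : E.domain) : R (E x) = z • R x - x := by
  rw [eq_sub_iff_add_eq, ← eq_sub_iff_add_eq', ← map_smul, ← map_sub, hR.left_inv]

theorem sub_apply (hR : IsResolventAt E z R) (hS : IsResolventAt E w S) (y : H) :
    R y - S y = (w - z) • R (S y) := by
  have hRS := hR.apply_map ⟨S y, hS.mem_domain y⟩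
  rw [hS.apply_eq, map_sub, map_smul] at hRS
  linear_combination (norm := module) -hRS

theorem commute (hR : IsResolventAt E z R) (hS : IsResolventAt E w S) : Commute R S := by
  rcases eq_or_ne w z with rfl | hzw
  · rw [hR.unique hS]
  ext y
  refine smul_right_injective H (sub_ne_zero.2 hzw) ?_
  calc (w - z) • R (S y) = R y - S y := (hR.sub_apply hS y).symm
    _ = -(z - w) • S (R y) := by rw [neg_smul, ← hS.sub_apply hR, neg_sub]
    _ = (w - z) • S (R y) := by rw [neg_sub]

end IsResolventAt

theorem IsC0Semigroup.isGeneratorOf_iff {T : ℝ → H →L[ℂ] H} (hT : IsC0Semigroup T) :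
    IsGeneratorOf E T ↔
      ∀ x y, (x, y) ∈ E.graph ↔ HasDerivWithinAt (fun t => T t x) y (Set.Ici 0) 0 :=
  forall₂_congr fun _ _ => by rw [hT.tendsto_smul_sub_iff_hasDerivWithinAt]

theorem IsBoundedC0Semigroup.isGeneratorOf_of_isResolventAt {T : ℝ → H →L[ℂ] H} {M : ℝ}
    (hT : IsBoundedC0Semigroup T M)
    (hE : ∀ x : E.domain, HasDerivWithinAt (fun t => T t x) (E x) (Set.Ici 0) 0)
    {z : ℂ} (hz : 0 < z.re) {R : H →L[ℂ] H} (hR : IsResolventAt E z R) : IsGeneratorOf E T := by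
  refine hT.isGeneratorOf_iff.2 fun x y => ⟨fun hxy => ?_, fun hxy => ?_⟩
  · obtain ⟨w, rfl, rfl⟩ := (LinearPMap.mem_graph_iff E).1 hxy
    exact hE w
  -- With `w = (z - E)⁻¹ (z x - y)`, the difference `x - w` is an eigenvector for `z`, hence zero.
  · let w : E.domain := ⟨R (z • x - y), hR.mem_domain _⟩
    have hEw : E w = z • (w : H) - (z • x - y) := hR.apply_eq _
    have heigen : HasDerivWithinAt (fun t => T t (x - w)) (z • (x - (w : H))) (Set.Ici 0) 0 := by
      convert hxy.fun_sub (hE w) using 1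
      · simp only [map_sub]
      · rw [hEw]; module
    have hxw : x = w := sub_eq_zero.1 (hT.eq_zero_of_eigenvector hz heigen)
    refine (LinearPMap.mem_graph_iff E).2 ⟨w, hxw.symm, ?_⟩
    rw [hEw, ← hxw]; abel

end Resolvent

section LimitSemigroup

open NormedSpace

variable {X : Type*} [NormedAddCommGroup X] [NormedSpace ℂ X] [CompleteSpace X]
  {A : ℕ → X →L[ℂ] X} {M : ℝ}

theorem cauchySeq_exp_smul_apply (hcomm : ∀ m n, Commute (A m) (A n))
    (hA : ∀ n (t : ℝ), 0 ≤ t → ‖exp (t • A n)‖ ≤ M) {t : ℝ} (ht : 0 ≤ t) {x : X}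
    (hx : CauchySeq fun n => A n x) : CauchySeq fun n => exp (t • A n) x := by
  have hlim := cauchySeq_iff_tendsto_dist_atTop_0.1 hx
  refine cauchySeq_iff_tendsto_dist_atTop_0.2 (squeeze_zero (fun _ => dist_nonneg) (fun p => ?_)
    (by simpa using ((hlim.const_mul M).const_mul M).mul_const t))
  simpa only [dist_eq_norm] using
    norm_exp_smul_sub_exp_smul_apply_le (hcomm p.1 p.2) (hA p.1) (hA p.2) ht x

theorem exists_tendsto_exp_smul_apply {s : Set X} (hs : Dense s)
    (hcomm : ∀ m n, Commute (A m) (A n)) (hA : ∀ n (t : ℝ), 0 ≤ t → ‖exp (t • A n)‖ ≤ M)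
    (hconv : ∀ x ∈ s, CauchySeq fun n => A n x) :
    ∃ T : ℝ → X →L[ℂ] X, ∀ t : ℝ, 0 ≤ t →
      ‖T t‖ ≤ M ∧ ∀ x, Tendsto (fun n => exp (t • A n) x) atTop (𝓝 (T t x)) := by
  have hexists : ∀ t : ℝ, ∃ V : X →L[ℂ] X, 0 ≤ t →
      ‖V‖ ≤ M ∧ ∀ x, Tendsto (fun n => exp (t • A n) x) atTop (𝓝 (V x)) := by
    intro t
    by_cases ht : 0 ≤ t
    · choose z hz using fun x => cauchySeq_tendsto_of_complete <|
        cauchySeq_apply_of_dense (fun n => hA n t ht) hs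
          (fun x hx => cauchySeq_exp_smul_apply hcomm hA ht (hconv x hx)) x
      refine ⟨continuousLinearMapOfTendsto (fun n => exp (t • A n)) (tendsto_pi_nhds.2 hz),
        fun _ => ⟨?_, hz⟩⟩
      exact ContinuousLinearMap.opNorm_le_bound _ ((norm_nonneg _).trans (hA 0 t ht)) fun x =>
        le_of_tendsto (hz x).norm <| Eventually.of_forall fun n =>
          (exp (t • A n)).le_of_opNorm_le (hA n t ht) x
    · exact ⟨0, fun h => absurd h ht⟩
  exact ⟨fun t => (hexists t).choose, fun t => (hexists t).choose_spec⟩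

theorem apply_sub_eq_integral_of_tendsto_exp (hA : ∀ n (t : ℝ), 0 ≤ t → ‖exp (t • A n)‖ ≤ M)
    {T : ℝ → X →L[ℂ] X}
    (hT : ∀ t : ℝ, 0 ≤ t → ∀ x, Tendsto (fun n => exp (t • A n) x) atTop (𝓝 (T t x)))
    {x y : X} (hxy : Tendsto (fun n => A n x) atTop (𝓝 y)) {t : ℝ} (ht : 0 ≤ t) :
    T t x - x = ∫ s in (0 : ℝ)..t, T s y := by
  obtain ⟨C, hC⟩ := hxy.norm.bddAbove_range
  refine tendsto_nhds_unique (((hT t ht x).sub_const x).congr fun n =>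
    exp_smul_apply_sub_eq_integral (A n) x t) ?_
  refine intervalIntegral.tendsto_integral_filter_of_dominated_convergence (fun _ => M * C)
    (Eventually.of_forall fun n => (continuous_exp_smul_apply _ _).aestronglyMeasurable)
    (Eventually.of_forall fun n => ae_of_all _ fun s hs => ?_)
    intervalIntegrable_const (ae_of_all _ fun s hs => ?_)
  all_goals rw [Set.uIoc_of_le ht] at hs
  · exact (exp (s • A n)).le_of_opNorm_le_of_le (hA n s hs.1.le) (hC ⟨n, rfl⟩)
  · exact tendsto_apply_apply (fun n => hA n s hs.1.le) (hT s hs.1.le y) hxy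

end LimitSemigroup

section HilleYosida

open NormedSpace

variable {H : Type u} [NormedAddCommGroup H] [InnerProductSpace ℂ H] {T : ℝ → H →L[ℂ] H} {M : ℝ}

theorem tendsto_apply_nhdsGT_zero_of_dense (hM : ∀ t : ℝ, 0 ≤ t → ‖T t‖ ≤ M) {s : Set H}
    (hs : Dense s) (h : ∀ x ∈ s, Tendsto (fun t : ℝ => T t x) (𝓝[>] 0) (𝓝 x)) (x : H) :
    Tendsto (fun t : ℝ => T t x) (𝓝[>] 0) (𝓝 x) := by
  have habs : ∀ y, (fun t : ℝ => T |t| y) =ᶠ[𝓝[>] 0] fun t => T t y := fun y => by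
    filter_upwards [self_mem_nhdsWithin] with t ht
    rw [abs_of_pos (Set.mem_Ioi.1 ht)]
  refine Tendsto.congr' (habs x) (tendsto_apply_of_dense (F := fun t : ℝ => T |t|)
    (G := ContinuousLinearMap.id ℂ H) (fun t => hM _ (abs_nonneg t)) hs (fun y hy => ?_) x)
  exact (h y hy).congr' (habs y).symm

theorem norm_apply_sub_le_of_eq_integral (hM : ∀ t : ℝ, 0 ≤ t → ‖T t‖ ≤ M) {x y : H} {t : ℝ}
    (ht : 0 ≤ t) (hxy : T t x - x = ∫ s in (0 : ℝ)..t, T s y) : ‖T t x - x‖ ≤ M * ‖y‖ * t := by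
  rw [hxy]
  convert intervalIntegral.norm_integral_le_of_norm_le_const (a := 0) (b := t) fun s hs => ?_
  · rw [sub_zero, abs_of_nonneg ht]
  · rw [Set.uIoc_of_le ht] at hs
    exact (T s).le_of_opNorm_le (hM s hs.1.le) y

theorem IsBoundedC0Semigroup.hasDerivWithinAt_of_eq_integral [CompleteSpace H]
    (hT : IsBoundedC0Semigroup T M) {x y : H}
    (hxy : ∀ t : ℝ, 0 ≤ t → T t x - x = ∫ s in (0 : ℝ)..t, T s y) :
    HasDerivWithinAt (fun t => T t x) y (Set.Ici 0) 0 := by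
  have hderiv : HasDerivWithinAt (fun t : ℝ => x + ∫ s in (0 : ℝ)..t, T |s| y) y (Set.Ici 0) 0 := by
    simpa [hT.apply_zero] using
      (((hT.continuous_abs_orbit y).integral_hasStrictDerivAt 0 0).hasDerivAt.const_add
        x).hasDerivWithinAt
  refine hderiv.congr (fun t ht => ?_) (by simp [hT.apply_zero])
  rw [← sub_eq_iff_eq_add', hxy t ht]
  refine intervalIntegral.integral_congr fun s hs => ?_
  rw [Set.uIcc_of_le ht] at hs
  simp only [abs_of_nonneg hs.1]

theorem exists_isBoundedC0Semigroup_of_tendsto [CompleteSpace H] {A : ℕ → H →L[ℂ] H}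
    {E : H →ₗ.[ℂ] H} (hE : Dense (E.domain : Set H)) (hcomm : ∀ m n, Commute (A m) (A n))
    (hA : ∀ n (t : ℝ), 0 ≤ t → ‖exp (t • A n)‖ ≤ M)
    (hlim : ∀ x : E.domain, Tendsto (fun n => A n x) atTop (𝓝 (E x))) :
    ∃ T : ℝ → H →L[ℂ] H, IsBoundedC0Semigroup T M ∧
      ∀ x : E.domain, HasDerivWithinAt (fun t => T t x) (E x) (Set.Ici 0) 0 := by
  obtain ⟨T, hT⟩ := exists_tendsto_exp_smul_apply hE hcomm hA
    fun x hx => (hlim ⟨x, hx⟩).cauchySeq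
  have hTM : ∀ t : ℝ, 0 ≤ t → ‖T t‖ ≤ M := fun t ht => (hT t ht).1
  have hintegral : ∀ (x : E.domain) (t : ℝ), 0 ≤ t →
      T t x - x = ∫ s in (0 : ℝ)..t, T s (E x) := fun x t ht =>
    apply_sub_eq_integral_of_tendsto_exp hA (fun t ht => (hT t ht).2) (hlim x) ht
  have hcont : ∀ x ∈ E.domain, Tendsto (fun t : ℝ => T t x) (𝓝[>] 0) (𝓝 x) := fun x hx => by
    refine tendsto_iff_norm_sub_tendsto_zero.2 (squeeze_zero' (g := fun t => M * ‖E ⟨x, hx⟩‖ * t)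
      (Eventually.of_forall fun _ => norm_nonneg _) ?_ ?_)
    · filter_upwards [self_mem_nhdsWithin] with t ht
      exact norm_apply_sub_le_of_eq_integral hTM (le_of_lt ht) (hintegral ⟨x, hx⟩ t (le_of_lt ht))
    · exact tendsto_nhdsWithin_of_tendsto_nhds (Continuous.tendsto' (by fun_prop) _ _ (by simp))
  have hbounded : IsBoundedC0Semigroup T M :=
    { map_zero := by
        ext x
        exact tendsto_nhds_unique ((hT 0 le_rfl).2 x) (by simp)
      map_add := fun s t hs ht => by
        ext x
        refine tendsto_nhds_unique ((hT (s + t) (add_nonneg hs ht)).2 x) ?_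
        simp only [exp_add_smul, mul_apply_eq_comp, ContinuousLinearMap.comp_apply]
        exact tendsto_apply_apply (fun n => hA n s hs) ((hT s hs).2 _) ((hT t ht).2 x)
      strongly_continuous := tendsto_apply_nhdsGT_zero_of_dense hTM hE hcont
      norm_le := hTM }
  exact ⟨T, hbounded, fun x => hbounded.hasDerivWithinAt_of_eq_integral (hintegral x)⟩

/-- The Yosida approximation `r (r R(r) - 1)`, which is `r E (r - E)⁻¹` when `R(r) = (r - E)⁻¹`:
bounded operators converging to `E` on its domain as `r → ∞`. -/
noncomputable def yosidaApprox (R : ℝ → H →L[ℂ] H) (r : ℝ) : H →L[ℂ] H :=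
  r • (r • R r - 1)

variable {E : H →ₗ.[ℂ] H} {R : ℝ → H →L[ℂ] H}

theorem yosidaApprox_apply {r : ℝ} (hR : IsResolventAt E r (R r)) (x : E.domain) :
    yosidaApprox R r x = (r • R r) (E x) := by
  simp only [yosidaApprox, smul_apply, sub_apply, one_apply_eq_self, hR.apply_map x,
    Complex.coe_smul]

theorem tendsto_smul_resolvent_apply (hE : Dense (E.domain : Set H))
    (hR : ∀ r : ℝ, 0 < r → IsResolventAt E r (R r)) (hRM : ∀ r : ℝ, 0 < r → ‖r • R r‖ ≤ M)
    (x : H) : Tendsto (fun n : ℕ => (((n : ℝ) + 1) • R (n + 1)) x) atTop (𝓝 x) := by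
  have hpos : ∀ n : ℕ, (0 : ℝ) < n + 1 := fun n => n.cast_add_one_pos
  refine tendsto_apply_of_dense (G := ContinuousLinearMap.id ℂ H) (fun n => hRM _ (hpos n)) hE
    (fun y hy => tendsto_iff_norm_sub_tendsto_zero.2 ?_) x
  have hzero : Tendsto (fun n : ℕ => (1 / ((n : ℝ) + 1)) * (M * ‖E ⟨y, hy⟩‖)) atTop (𝓝 0) := by
    simpa using tendsto_one_div_add_atTop_nhds_zero_nat.mul_const (M * ‖E ⟨y, hy⟩‖)
  refine squeeze_zero (fun _ => norm_nonneg _) (fun n => ?_) hzero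
  have hyosida := yosidaApprox_apply (hR _ (hpos n)) ⟨y, hy⟩
  have hbound := (((n : ℝ) + 1) • R (n + 1)).le_of_opNorm_le (hRM _ (hpos n)) (E ⟨y, hy⟩)
  rw [← hyosida, yosidaApprox, smul_apply, norm_smul, Real.norm_of_nonneg (hpos n).le] at hbound
  rw [one_div_mul_eq_div, le_div_iff₀' (hpos n)]
  exact hbound

theorem commute_yosidaApprox {r s : ℝ} (hr : IsResolventAt E r (R r))
    (hs : IsResolventAt E s (R s)) : Commute (yosidaApprox R r) (yosidaApprox R s) := by
  have hRR : Commute (r • R r) (s • R s) := ((hr.commute hs).smul_left r).smul_right s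
  exact ((((hRR.sub_right (Commute.one_right _)).sub_left (Commute.one_left _)).smul_left
    r).smul_right s)

theorem exists_isBoundedC0Semigroup_of_norm_resolvent_pow_le [CompleteSpace H]
    (hE : Dense (E.domain : Set H)) (hR : ∀ r : ℝ, 0 < r → IsResolventAt E r (R r))
    (hRM : ∀ r : ℝ, 0 < r → ∀ k : ℕ, ‖(r • R r) ^ k‖ ≤ M) :
    ∃ T : ℝ → H →L[ℂ] H, IsBoundedC0Semigroup T M ∧ IsGeneratorOf E T := by
  have hpos : ∀ n : ℕ, (0 : ℝ) < n + 1 := fun n => n.cast_add_one_pos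
  obtain ⟨T, hT, hTE⟩ := exists_isBoundedC0Semigroup_of_tendsto (M := M) (E := E)
    (A := fun n : ℕ => yosidaApprox R (n + 1)) hE
    (fun m n => commute_yosidaApprox (hR _ (hpos m)) (hR _ (hpos n)))
    (fun n t ht => by
      rw [yosidaApprox, smul_smul]
      exact norm_exp_smul_sub_one_le (hRM _ (hpos n)) (mul_nonneg ht (hpos n).le))
    (fun x => by
      simp only [yosidaApprox_apply (hR _ (hpos _))]
      exact tendsto_smul_resolvent_apply hE hR (fun r hr => by simpa using hRM r hr 1) (E x))
  exact ⟨T, hT, hT.isGeneratorOf_of_isResolventAt hTE (z := ((1 : ℝ) : ℂ)) (by simp)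
    (hR 1 one_pos)⟩

end HilleYosida

section SquareIntegrable

variable {α K : Type*} {m : MeasurableSpace α} {μ : Measure α}

theorem eLpNorm_two_sq {ε : Type*} [TopologicalSpace ε] [ContinuousENorm ε] (f : α → ε) :
    eLpNorm f 2 μ ^ 2 = ∫⁻ a, ‖f a‖ₑ ^ 2 ∂μ := by
  simpa using eLpNorm_nnreal_pow_eq_lintegral (μ := μ) (f := f) (p := 2) two_ne_zero

variable [NormedAddCommGroup K] {f g : α → K}

theorem memLp_two_of_lintegral_lt_top (hf : AEStronglyMeasurable f μ)
    (hf_top : ∫⁻ a, ‖f a‖ₑ ^ 2 ∂μ < ⊤) : MemLp f 2 μ := by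
  rw [← eLpNorm_two_sq, ENNReal.pow_lt_top_iff] at hf_top
  exact ⟨hf, hf_top.resolve_right two_ne_zero⟩

theorem ofReal_integral_norm_sq (hf : MemLp f 2 μ) :
    ENNReal.ofReal (∫ a, ‖f a‖ ^ 2 ∂μ) = ∫⁻ a, ‖f a‖ₑ ^ 2 ∂μ := by
  rw [ofReal_integral_eq_lintegral_ofReal ((memLp_two_iff_integrable_sq_norm hf.1).1 hf)
    (Eventually.of_forall fun a => by positivity)]
  simp only [ENNReal.ofReal_pow (norm_nonneg _), ofReal_norm]

theorem integral_norm_sq_le (hf : MemLp f 2 μ) {c : ℝ} (hc : 0 ≤ c)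
    (hf_le : ∫⁻ a, ‖f a‖ₑ ^ 2 ∂μ ≤ ENNReal.ofReal c) : ∫ a, ‖f a‖ ^ 2 ∂μ ≤ c := by
  rwa [← ofReal_integral_norm_sq hf, ENNReal.ofReal_le_ofReal_iff hc] at hf_le

theorem norm_toLp_two (hf : MemLp f 2 μ) : ‖hf.toLp f‖ = √(∫ a, ‖f a‖ ^ 2 ∂μ) := by
  rw [Lp.norm_toLp, eq_comm, Real.sqrt_eq_iff_mul_self_eq (integral_nonneg fun a => sq_nonneg _)
    ENNReal.toReal_nonneg, ← sq, ← ENNReal.toReal_pow, eLpNorm_two_sq,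
    ← ofReal_integral_norm_sq hf, ENNReal.toReal_ofReal (integral_nonneg fun a => sq_nonneg _)]

variable [InnerProductSpace ℂ K]

theorem integrable_inner_of_memLp (hf : MemLp f 2 μ) (hg : MemLp g 2 μ) :
    Integrable (fun a => inner ℂ (f a) (g a)) μ := by
  refine (L2.integrable_inner (𝕜 := ℂ) (hf.toLp f) (hg.toLp g)).congr ?_
  filter_upwards [hf.coeFn_toLp, hg.coeFn_toLp] with a hfa hga
  rw [hfa, hga]

theorem integral_inner_eq_inner_toLp (hf : MemLp f 2 μ) (hg : MemLp g 2 μ) :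
    ∫ a, inner ℂ (f a) (g a) ∂μ = inner ℂ (hf.toLp f) (hg.toLp g) := by
  rw [L2.inner_def]
  refine integral_congr_ae ?_
  filter_upwards [hf.coeFn_toLp, hg.coeFn_toLp] with a hfa hga
  rw [hfa, hga]

theorem norm_integral_inner_le (hf : MemLp f 2 μ) (hg : MemLp g 2 μ) :
    ‖∫ a, inner ℂ (f a) (g a) ∂μ‖ ≤ √(∫ a, ‖f a‖ ^ 2 ∂μ) * √(∫ a, ‖g a‖ ^ 2 ∂μ) := by
  rw [integral_inner_eq_inner_toLp hf hg, ← norm_toLp_two hf, ← norm_toLp_two hg]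
  exact norm_inner_le_norm _ _

end SquareIntegrable

section GramOperator

variable {ι H : Type*} [NormedAddCommGroup H] [InnerProductSpace ℂ H]
variable (𝒰 : Ultrafilter ι)

theorem exists_tendsto_ultrafilter_of_norm_le {b : ι → ℂ} {M : ℝ}
    (hb : ∀ᶠ i in (𝒰 : Filter ι), ‖b i‖ ≤ M) : ∃ z, Tendsto b 𝒰 (𝓝 z) := by
  obtain ⟨z, -, hz⟩ := (isCompact_closedBall (0 : ℂ) M).ultrafilter_le_nhds (𝒰.map b) <| by
    rw [le_principal_iff, Ultrafilter.mem_coe, Ultrafilter.mem_map]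
    filter_upwards [hb] with i hi
    simpa using hi
  exact ⟨z, hz⟩

theorem exists_tendsto_inner_of_eventually_sesquilinear [CompleteSpace H]
    {b : ι → H → H → ℂ} {M : ℝ}
    (add_left : ∀ x y z, ∀ᶠ i in (𝒰 : Filter ι), b i (x + y) z = b i x z + b i y z)
    (smul_left : ∀ (c : ℂ) x z, ∀ᶠ i in (𝒰 : Filter ι), b i (c • x) z = starRingEnd ℂ c * b i x z)
    (add_right : ∀ x y z, ∀ᶠ i in (𝒰 : Filter ι), b i x (y + z) = b i x y + b i x z)
    (smul_right : ∀ (c : ℂ) x z, ∀ᶠ i in (𝒰 : Filter ι), b i x (c • z) = c * b i x z)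
    (bound : ∀ x y, ∀ᶠ i in (𝒰 : Filter ι), ‖b i x y‖ ≤ M * ‖x‖ * ‖y‖) :
    ∃ Q : H →L[ℂ] H, ∀ x y, Tendsto (fun i => b i x y) 𝒰 (𝓝 (inner ℂ (Q x) y)) := by
  choose B hB using fun x y => exists_tendsto_ultrafilter_of_norm_le 𝒰 (bound x y)
  let L : H →ₗ⋆[ℂ] H →ₗ[ℂ] ℂ := LinearMap.mk₂'ₛₗ (starRingEnd ℂ) (RingHom.id ℂ) B
    (fun x y z => tendsto_nhds_unique_of_eventuallyEq (hB _ _) ((hB x z).add (hB y z))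
      (add_left x y z))
    (fun c x z => tendsto_nhds_unique_of_eventuallyEq (hB _ _) ((hB x z).const_mul _)
      (smul_left c x z))
    (fun x y z => tendsto_nhds_unique_of_eventuallyEq (hB _ _) ((hB x y).add (hB x z))
      (add_right x y z))
    (fun c x z => tendsto_nhds_unique_of_eventuallyEq (hB _ _) ((hB x z).const_mul _)
      (smul_right c x z))
  have norm_L_le x y : ‖L x y‖ ≤ M * ‖x‖ * ‖y‖ := le_of_tendsto (hB x y).norm (bound x y)
  refine ⟨InnerProductSpace.continuousLinearMapOfBilin (L.mkContinuous₂ M norm_L_le),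
    fun x y => ?_⟩
  rw [InnerProductSpace.continuousLinearMapOfBilin_apply]
  exact hB x y

variable {α K : Type*} [MeasurableSpace α] [NormedAddCommGroup K] [InnerProductSpace ℂ K]

/-- Along the ultrafilter `𝒰`, the Gram forms `⟨F i x, F i y⟩` in `L²(μ i)` converge to the form
`⟨Q x, y⟩`. -/
structure IsGramOperator (μ : ι → Measure α) (F : ι → H →ₗ[ℂ] α → K) (Q : H →L[ℂ] H) :
    Prop where
  memLp : ∀ x, ∀ᶠ i in (𝒰 : Filter ι), MemLp (F i x) 2 (μ i)
  tendsto_inner : ∀ x y,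
    Tendsto (fun i => ∫ a, inner ℂ (F i x a) (F i y a) ∂μ i) 𝒰 (𝓝 (inner ℂ (Q x) y))

variable {𝒰} {μ : ι → Measure α} {F : ι → H →ₗ[ℂ] α → K}

variable (𝒰) in
theorem exists_isGramOperator [CompleteSpace H] {M : ℝ} (hM : 0 ≤ M)
    (hF : ∀ x, ∀ᶠ i in (𝒰 : Filter ι), AEStronglyMeasurable (F i x) (μ i))
    (bound : ∀ x, ∀ᶠ i in (𝒰 : Filter ι),
      ∫⁻ a, ‖F i x a‖ₑ ^ 2 ∂μ i ≤ ENNReal.ofReal ((M * ‖x‖) ^ 2)) :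
    ∃ Q : H →L[ℂ] H, IsGramOperator 𝒰 μ F Q := by
  have memLp x : ∀ᶠ i in (𝒰 : Filter ι), MemLp (F i x) 2 (μ i) := by
    filter_upwards [hF x, bound x] with i hx hx_le
    exact memLp_two_of_lintegral_lt_top hx (hx_le.trans_lt ENNReal.ofReal_lt_top)
  obtain ⟨Q, hQ⟩ := exists_tendsto_inner_of_eventually_sesquilinear 𝒰
    (b := fun i x y => ∫ a, inner ℂ (F i x a) (F i y a) ∂μ i) (M := M * M)
    (fun x y z => by
      filter_upwards [memLp x, memLp y, memLp z] with i hx hy hz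
      rw [← integral_add (integrable_inner_of_memLp hx hz) (integrable_inner_of_memLp hy hz)]
      simp only [map_add, Pi.add_apply, inner_add_left])
    (fun c x z => Eventually.of_forall fun i => by
      simp only [map_smul, Pi.smul_apply, inner_smul_left, integral_const_mul])
    (fun x y z => by
      filter_upwards [memLp x, memLp y, memLp z] with i hx hy hz
      rw [← integral_add (integrable_inner_of_memLp hx hy) (integrable_inner_of_memLp hx hz)]
      simp only [map_add, Pi.add_apply, inner_add_right])
    (fun c x z => Eventually.of_forall fun i => by
      simp only [map_smul, Pi.smul_apply, inner_smul_right, integral_const_mul])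
    (fun x y => by
      filter_upwards [memLp x, memLp y, bound x, bound y] with i hx hy hx_le hy_le
      calc _ ≤ √(∫ a, ‖F i x a‖ ^ 2 ∂μ i) * √(∫ a, ‖F i y a‖ ^ 2 ∂μ i) :=
            norm_integral_inner_le hx hy
        _ ≤ (M * ‖x‖) * (M * ‖y‖) := by
            gcongr <;> refine Real.sqrt_le_iff.2 ⟨by positivity, ?_⟩
            exacts [integral_norm_sq_le hx (by positivity) hx_le,
              integral_norm_sq_le hy (by positivity) hy_le]
        _ = M * M * ‖x‖ * ‖y‖ := by ring)
  exact ⟨Q, memLp, hQ⟩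

namespace IsGramOperator

variable {Q : H →L[ℂ] H}

theorem tendsto_integral_norm_sq_complex (hQ : IsGramOperator 𝒰 μ F Q) (x : H) :
    Tendsto (fun i => ((∫ a, ‖F i x a‖ ^ 2 ∂μ i : ℝ) : ℂ)) 𝒰 (𝓝 (inner ℂ (Q x) x)) := by
  refine (hQ.tendsto_inner x x).congr fun i => ?_
  rw [← integral_complex_ofReal]
  simp only [inner_self_eq_norm_sq_to_K, Complex.ofReal_pow, Complex.coe_algebraMap]

theorem tendsto_integral_norm_sq (hQ : IsGramOperator 𝒰 μ F Q) (x : H) :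
    Tendsto (fun i => ∫ a, ‖F i x a‖ ^ 2 ∂μ i) 𝒰 (𝓝 (Q.reApplyInnerSelf x)) :=
  (Complex.continuous_re.tendsto _).comp (hQ.tendsto_integral_norm_sq_complex x)

theorem isPositive (hQ : IsGramOperator 𝒰 μ F Q) : Q.IsPositive := by
  refine (ContinuousLinearMap.isPositive_iff_complex Q).2 fun x => ⟨?_, ?_⟩
  · exact tendsto_nhds_unique ((Complex.continuous_ofReal.tendsto _).comp
      (hQ.tendsto_integral_norm_sq x)) (hQ.tendsto_integral_norm_sq_complex x)
  · exact ge_of_tendsto' (hQ.tendsto_integral_norm_sq x) fun i =>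
      integral_nonneg fun a => sq_nonneg _

end IsGramOperator

end GramOperator

section Similarity

variable {H : Type u} [NormedAddCommGroup H] [InnerProductSpace ℂ H]

theorem isUnit_of_le_reApplyInnerSelf [CompleteSpace H] {Q : H →L[ℂ] H} {m : ℝ} (hm : 0 < m)
    (hQ : ∀ x, m * ‖x‖ ^ 2 ≤ Q.reApplyInnerSelf x) : IsUnit Q := by
  refine Q.isUnit_of_forall_le_norm_inner_map (c := ⟨m, hm.le⟩) (by exact_mod_cast hm) fun x => ?_
  calc ‖x‖ ^ 2 * m = m * ‖x‖ ^ 2 := mul_comm _ _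
    _ ≤ Q.reApplyInnerSelf x := hQ x
    _ ≤ ‖inner ℂ (Q x) x‖ := Complex.re_le_norm _

theorem exists_equiv_norm_sq_eq_reApplyInnerSelf [CompleteSpace H] {Q : H →L[ℂ] H}
    (hQ : Q.IsPositive) (hQ_unit : IsUnit Q) :
    ∃ W : H ≃L[ℂ] H, ∀ x, ‖W x‖ ^ 2 = Q.reApplyInnerSelf x := by
  have Q_nonneg : 0 ≤ Q := (ContinuousLinearMap.nonneg_iff_isPositive Q).2 hQ
  obtain ⟨w, hw⟩ := (CFC.isUnit_sqrt_iff Q Q_nonneg).2 hQ_unit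
  have sqrt_symm : (CFC.sqrt Q).IsSymmetric :=
    ((ContinuousLinearMap.nonneg_iff_isPositive _).1 (CFC.sqrt_nonneg Q)).isSymmetric
  have sqrt_sqrt x : CFC.sqrt Q (CFC.sqrt Q x) = Q x :=
    DFunLike.congr_fun (CFC.sqrt_mul_sqrt_self Q Q_nonneg) x
  refine ⟨ContinuousLinearEquiv.ofUnit w, fun x => ?_⟩
  have W_apply : ContinuousLinearEquiv.ofUnit w x = CFC.sqrt Q x := DFunLike.congr_fun hw x
  rw [W_apply, ← inner_self_eq_norm_sq (𝕜 := ℂ), ContinuousLinearMap.reApplyInnerSelf_apply,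
    ← sqrt_sqrt x]
  exact congrArg RCLike.re (sqrt_symm (CFC.sqrt Q x) x).symm

variable {T : ℝ → H →L[ℂ] H}

theorem IsC0Semigroup.conj (hT : IsC0Semigroup T) (W : H ≃L[ℂ] H) :
    IsC0Semigroup fun t => (W : H →L[ℂ] H) ∘L T t ∘L (W.symm : H →L[ℂ] H) where
  map_zero := by
    ext x
    simp [hT.map_zero]
  map_add s t hs ht := by
    ext x
    simp [hT.map_add s t hs ht]
  strongly_continuous x := by
    simpa [Function.comp_def] using
      (W.continuous.tendsto _).comp (hT.strongly_continuous (W.symm x))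

theorem IsC0Semigroup.isSimilarToIsometricSemigroup_of_isPositive [CompleteSpace H]
    (hT : IsC0Semigroup T) {Q : H →L[ℂ] H} (hQ : Q.IsPositive) (hQ_unit : IsUnit Q)
    (hQT : ∀ t, 0 ≤ t → ∀ x, Q.reApplyInnerSelf (T t x) = Q.reApplyInnerSelf x) :
    IsSimilarToIsometricSemigroup T := by
  obtain ⟨W, hW⟩ := exists_equiv_norm_sq_eq_reApplyInnerSelf hQ hQ_unit
  refine ⟨_, W, hT.conj W, fun t ht x => ?_, fun t _ x => rfl⟩
  rw [← sq_eq_sq₀ (norm_nonneg _) (norm_nonneg _)]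
  calc ‖W (T t (W.symm x))‖ ^ 2 = ‖W (W.symm x)‖ ^ 2 := by rw [hW, hQT t ht, ← hW]
    _ = ‖x‖ ^ 2 := by rw [W.apply_symm_apply]

theorem norm_le_of_norm_apply_eq {V W : Type*} [NormedAddCommGroup V] [NormedSpace ℂ V]
    [NormedAddCommGroup W] [NormedSpace ℂ W] (R : V ≃L[ℂ] W) {x y : V} (hxy : ‖R x‖ = ‖R y‖) :
    ‖x‖ ≤ ‖(R.symm : W →L[ℂ] V)‖ * ‖(R : V →L[ℂ] W)‖ * ‖y‖ :=
  calc ‖x‖ = ‖(R.symm : W →L[ℂ] V) (R x)‖ := by simp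
    _ ≤ ‖(R.symm : W →L[ℂ] V)‖ * ‖R x‖ := ContinuousLinearMap.le_opNorm _ _
    _ = ‖(R.symm : W →L[ℂ] V)‖ * ‖R y‖ := by rw [hxy]
    _ ≤ ‖(R.symm : W →L[ℂ] V)‖ * (‖(R : V →L[ℂ] W)‖ * ‖y‖) := by
        gcongr
        exact (R : V →L[ℂ] W).le_opNorm y
    _ = _ := by ring

theorem IsSimilarToIsometricSemigroup.exists_bounds (hT : IsC0Semigroup T)
    (hsim : IsSimilarToIsometricSemigroup T) :
    ∃ m M, 0 < m ∧ 0 < M ∧ IsBoundedC0Semigroup T M ∧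
      ∀ t, 0 ≤ t → ∀ x, m * ‖x‖ ≤ ‖T t x‖ := by
  obtain ⟨S, R, -, norm_S, hRS⟩ := hsim
  have norm_R_apply t (ht : 0 ≤ t) x : ‖R (T t x)‖ = ‖R x‖ := by
    rw [← norm_S t ht (R x), ← hRS t ht, R.symm_apply_apply]
  let M := ‖(R.symm : H →L[ℂ] H)‖ * ‖(R : H →L[ℂ] H)‖ + 1
  have M_pos : 0 < M := by positivity
  have le_M x y (hxy : ‖R x‖ = ‖R y‖) : ‖x‖ ≤ M * ‖y‖ :=
    (norm_le_of_norm_apply_eq R hxy).trans (by gcongr; exact le_add_of_nonneg_right one_pos.le)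
  refine ⟨M⁻¹, M, inv_pos.2 M_pos, M_pos, ⟨hT, fun t ht => ?_⟩, fun t ht x => ?_⟩
  · exact (T t).opNorm_le_bound M_pos.le fun x => le_M _ _ (norm_R_apply t ht x)
  · exact (inv_mul_le_iff₀ M_pos).2 (le_M _ _ (norm_R_apply t ht x).symm)

end Similarity

section CesaroMeans

theorem tendsto_average_comp_add_right_sub {V : Type*} [NormedAddCommGroup V] [NormedSpace ℝ V]
    {f : ℝ → V} {B : ℝ} (hf : ∀ a b, IntervalIntegrable f volume a b) (hB : ∀ s, ‖f s‖ ≤ B)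
    (τ : ℝ) :
    Tendsto (fun t : ℝ => t⁻¹ • ((∫ s in (0)..t, f (s + τ)) - ∫ s in (0)..t, f s)) atTop
      (𝓝 0) := by
  have lim_bound : Tendsto (fun t : ℝ => t⁻¹ * (B * |τ| + B * |τ|)) atTop (𝓝 0) := by
    simpa using tendsto_inv_atTop_zero.mul_const (B * |τ| + B * |τ|)
  refine squeeze_zero_norm' ?_ lim_bound
  filter_upwards [eventually_gt_atTop 0] with t ht
  have integral_diff : (∫ s in (0)..t, f (s + τ)) - ∫ s in (0)..t, f s =
      (∫ s in t..(t + τ), f s) - ∫ s in (0)..τ, f s := by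
    rw [intervalIntegral.integral_comp_add_right, zero_add,
      intervalIntegral.integral_interval_sub_interval_comm (hf _ _) (hf _ _) (hf _ _),
      intervalIntegral.integral_symm τ 0, intervalIntegral.integral_symm (t + τ) t]
    abel
  rw [integral_diff, norm_smul, Real.norm_of_nonneg (inv_nonneg.2 ht.le)]
  gcongr
  calc _ ≤ ‖∫ s in t..(t + τ), f s‖ + ‖∫ s in (0)..τ, f s‖ := norm_sub_le _ _
    _ ≤ B * |t + τ - t| + B * |τ - 0| := add_le_add
        (intervalIntegral.norm_integral_le_of_norm_le_const fun s _ => hB s)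
        (intervalIntegral.norm_integral_le_of_norm_le_const fun s _ => hB s)
    _ = B * |τ| + B * |τ| := by rw [add_sub_cancel_left, sub_zero]

/-- The uniform probability measure on `[0, t]`, for `t > 0`; the Cesàro means are integrals
against it. -/
noncomputable def uniformMeasure (t : ℝ) : Measure ℝ :=
  ENNReal.ofReal (1 / t) • volume.restrict (Set.Icc 0 t)

theorem isProbabilityMeasure_uniformMeasure {t : ℝ} (ht : 0 < t) :
    IsProbabilityMeasure (uniformMeasure t) := by
  constructor
  rw [uniformMeasure, Measure.smul_apply, Measure.restrict_apply_univ, Real.volume_Icc, sub_zero,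
    smul_eq_mul, ← ENNReal.ofReal_mul (by positivity), one_div_mul_cancel ht.ne',
    ENNReal.ofReal_one]

theorem ae_uniformMeasure_nonneg (t : ℝ) : ∀ᵐ s ∂uniformMeasure t, 0 ≤ s :=
  Measure.ae_smul_measure ((ae_restrict_mem measurableSet_Icc).mono fun _ hs => hs.1) _

theorem integral_uniformMeasure {V : Type*} [NormedAddCommGroup V] [NormedSpace ℝ V] (f : ℝ → V)
    {t : ℝ} (ht : 0 ≤ t) : ∫ s, f s ∂uniformMeasure t = t⁻¹ • ∫ s in (0)..t, f s := by
  rw [uniformMeasure, integral_smul_measure, ENNReal.toReal_ofReal (by positivity), one_div,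
    integral_Icc_eq_integral_Ioc, intervalIntegral.integral_of_le ht]

section ProbabilityMeasure

variable {α V : Type*} [MeasurableSpace α] {μ : Measure α} [IsProbabilityMeasure μ]
  [NormedAddCommGroup V] {f : α → V} {c : ℝ}

theorem lintegral_enorm_sq_le (hf : ∀ᵐ a ∂μ, ‖f a‖ ≤ c) :
    ∫⁻ a, ‖f a‖ₑ ^ 2 ∂μ ≤ ENNReal.ofReal (c ^ 2) :=
  calc ∫⁻ a, ‖f a‖ₑ ^ 2 ∂μ ≤ ∫⁻ _, ENNReal.ofReal (c ^ 2) ∂μ := by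
        refine lintegral_mono_ae (hf.mono fun a ha => ?_)
        rw [← ofReal_norm, ← ENNReal.ofReal_pow (norm_nonneg _)]
        gcongr
    _ = ENNReal.ofReal (c ^ 2) := by rw [lintegral_const, measure_univ, mul_one]

theorem le_lintegral_enorm_sq (hc : 0 ≤ c) (hf : ∀ᵐ a ∂μ, c ≤ ‖f a‖) :
    ENNReal.ofReal (c ^ 2) ≤ ∫⁻ a, ‖f a‖ₑ ^ 2 ∂μ :=
  calc ENNReal.ofReal (c ^ 2) = ∫⁻ _, ENNReal.ofReal (c ^ 2) ∂μ := by
        rw [lintegral_const, measure_univ, mul_one]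
    _ ≤ ∫⁻ a, ‖f a‖ₑ ^ 2 ∂μ := by
        refine lintegral_mono_ae (hf.mono fun a ha => ?_)
        rw [← ofReal_norm, ← ENNReal.ofReal_pow (norm_nonneg _)]
        gcongr

end ProbabilityMeasure

end CesaroMeans

section BoundedBelow

variable {H : Type u} [NormedAddCommGroup H] [InnerProductSpace ℂ H]
variable {T : ℝ → H →L[ℂ] H} {M : ℝ}

/-- The orbits `s ↦ T(s) x`, extended evenly to negative times so as to be continuous on `ℝ`. -/
def orbitMap (T : ℝ → H →L[ℂ] H) : H →ₗ[ℂ] ℝ → H :=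
  LinearMap.pi fun s => (T |s| : H →ₗ[ℂ] H)

theorem orbitMap_apply (T : ℝ → H →L[ℂ] H) (x : H) (s : ℝ) : orbitMap T x s = T |s| x := rfl

namespace IsBoundedC0Semigroup

theorem continuous_orbitMap (hT : IsBoundedC0Semigroup T M) (x : H) :
    Continuous (orbitMap T x) :=
  hT.continuous_abs_orbit x

theorem norm_orbitMap_le (hT : IsBoundedC0Semigroup T M) (x : H) (s : ℝ) :
    ‖orbitMap T x s‖ ≤ M * ‖x‖ :=
  hT.norm_apply_le (abs_nonneg s) x

theorem tendsto_integral_orbitMap_apply_sub (hT : IsBoundedC0Semigroup T M) {τ : ℝ} (hτ : 0 ≤ τ)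
    (x : H) :
    Tendsto (fun t => ∫ s, ‖orbitMap T (T τ x) s‖ ^ 2 ∂uniformMeasure t
      - ∫ s, ‖orbitMap T x s‖ ^ 2 ∂uniformMeasure t) atTop (𝓝 0) := by
  have norm_sq_le s : ‖‖orbitMap T x s‖ ^ 2‖ ≤ (M * ‖x‖) ^ 2 := by
    rw [norm_pow, norm_norm]
    gcongr
    exact hT.norm_orbitMap_le x s
  refine (tendsto_average_comp_add_right_sub (fun a b =>
    ((hT.continuous_orbitMap x).norm.pow 2).intervalIntegrable a b) norm_sq_le τ).congr' ?_
  filter_upwards [eventually_ge_atTop 0] with t ht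
  have shift : ∫ s in (0)..t, ‖orbitMap T (T τ x) s‖ ^ 2 =
      ∫ s in (0)..t, ‖orbitMap T x (s + τ)‖ ^ 2 := by
    refine intervalIntegral.integral_congr fun s hs => ?_
    have s_nonneg : 0 ≤ s := (Set.uIcc_of_le ht ▸ hs).1
    simp only [orbitMap_apply, abs_of_nonneg s_nonneg, abs_of_nonneg (add_nonneg s_nonneg hτ),
      hT.apply_add s_nonneg hτ]
  rw [integral_uniformMeasure _ ht, integral_uniformMeasure _ ht, shift, smul_sub]
  simp only [Pi.pow_apply]

theorem exists_isGramOperator_orbitMap [CompleteSpace H] (hT : IsBoundedC0Semigroup T M)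
    {𝒰 : Ultrafilter ℝ} (h𝒰 : (𝒰 : Filter ℝ) ≤ atTop) :
    ∃ Q, IsGramOperator 𝒰 uniformMeasure (fun _ => orbitMap T) Q := by
  refine exists_isGramOperator 𝒰 hT.bound_nonneg (fun x => Eventually.of_forall fun t =>
    (hT.continuous_orbitMap x).aestronglyMeasurable) fun x => h𝒰 ?_
  filter_upwards [eventually_gt_atTop 0] with t ht
  have := isProbabilityMeasure_uniformMeasure ht
  exact lintegral_enorm_sq_le (Eventually.of_forall (hT.norm_orbitMap_le x))

theorem le_integral_norm_orbitMap_sq (hT : IsBoundedC0Semigroup T M) {m : ℝ} (hm : 0 ≤ m)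
    (hmT : ∀ t, 0 ≤ t → ∀ x, m * ‖x‖ ≤ ‖T t x‖) (x : H) {t : ℝ} (ht : 0 < t) :
    m ^ 2 * ‖x‖ ^ 2 ≤ ∫ s, ‖orbitMap T x s‖ ^ 2 ∂uniformMeasure t := by
  have := isProbabilityMeasure_uniformMeasure ht
  have memLp : MemLp (orbitMap T x) 2 (uniformMeasure t) :=
    .of_bound (hT.continuous_orbitMap x).aestronglyMeasurable _
      (Eventually.of_forall (hT.norm_orbitMap_le x))
  rw [← ENNReal.ofReal_le_ofReal_iff (by positivity), ofReal_integral_norm_sq memLp, ← mul_pow]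
  exact le_lintegral_enorm_sq (by positivity)
    (Eventually.of_forall fun s => hmT |s| (abs_nonneg s) x)

theorem isSimilarToIsometricSemigroup [CompleteSpace H] (hT : IsBoundedC0Semigroup T M) {m : ℝ}
    (hm : 0 < m) (hmT : ∀ t, 0 ≤ t → ∀ x, m * ‖x‖ ≤ ‖T t x‖) :
    IsSimilarToIsometricSemigroup T := by
  let 𝒰 : Ultrafilter ℝ := Ultrafilter.of atTop
  have h𝒰 : (𝒰 : Filter ℝ) ≤ atTop := Ultrafilter.of_le atTop
  obtain ⟨Q, hQ⟩ := hT.exists_isGramOperator_orbitMap h𝒰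
  have le_Q x : m ^ 2 * ‖x‖ ^ 2 ≤ Q.reApplyInnerSelf x :=
    ge_of_tendsto (hQ.tendsto_integral_norm_sq x) <| h𝒰 <| (eventually_gt_atTop 0).mono
      fun _ ht => hT.le_integral_norm_orbitMap_sq hm.le hmT x ht
  refine hT.toIsC0Semigroup.isSimilarToIsometricSemigroup_of_isPositive hQ.isPositive
    (isUnit_of_le_reApplyInnerSelf (by positivity) le_Q) fun τ hτ x => sub_eq_zero.1 ?_
  exact tendsto_nhds_unique
    ((hQ.tendsto_integral_norm_sq (T τ x)).sub (hQ.tendsto_integral_norm_sq x))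
    ((hT.tendsto_integral_orbitMap_apply_sub hτ x).mono_left h𝒰)

end IsBoundedC0Semigroup

end BoundedBelow

section WeightedCesaroMeans

variable {H : Type u} [NormedAddCommGroup H] [InnerProductSpace ℂ H]
variable {K : Type u} [NormedAddCommGroup K] [InnerProductSpace ℂ K]
variable {T : ℝ → H →L[ℂ] H} {C : H →ₗ.[ℂ] K}

theorem cesaroMean_eq_lintegral (C : H →ₗ.[ℂ] K) (T : ℝ → H →L[ℂ] H) (h : H) (t : ℝ) :
    cesaroMean C T h t = ∫⁻ s, ‖applyOp C (T s h)‖ₑ ^ 2 ∂uniformMeasure t := by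
  rw [uniformMeasure, lintegral_smul_measure, smul_eq_mul, cesaroMean]

theorem IsC0Semigroup.setLIntegral_apply (hT : IsC0Semigroup T) (f : H → ENNReal) (h : H) {τ : ℝ}
    (hτ : 0 ≤ τ) (t : ℝ) :
    ∫⁻ s in Set.Icc 0 t, f (T s (T τ h)) = ∫⁻ s in Set.Icc τ (t + τ), f (T s h) := by
  have shift := (measurePreserving_add_right volume τ).setLIntegral_comp_preimage_emb
    (measurableEmbedding_addRight τ) (fun s => f (T s h)) (Set.Icc τ (t + τ))
  rw [Set.preimage_add_const_Icc, sub_self, add_sub_cancel_right] at shift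
  rw [← shift]
  refine setLIntegral_congr_fun measurableSet_Icc fun s hs => ?_
  simp only [hT.apply_add hs.1 hτ]

theorem cesaroMean_apply_eq (hT : IsC0Semigroup T) (h : H) {τ : ℝ} (hτ : 0 ≤ τ) (t : ℝ) :
    cesaroMean C T (T τ h) t =
      ENNReal.ofReal (1 / t) * ∫⁻ s in Set.Icc τ (t + τ), ‖applyOp C (T s h)‖ₑ ^ 2 := by
  rw [cesaroMean, hT.setLIntegral_apply (fun x => ‖applyOp C x‖ₑ ^ 2) h hτ]

theorem eventually_cesaroMean_apply_le (hT : IsC0Semigroup T) (h : H) {τ : ℝ} (hτ : 0 ≤ τ) :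
    ∀ᶠ t in atTop, cesaroMean C T (T τ h) t ≤ 2 * cesaroMean C T h (t + τ) := by
  filter_upwards [eventually_ge_atTop τ, eventually_gt_atTop 0] with t hτt ht
  have weight_le : 1 / t ≤ 2 * (1 / (t + τ)) := by
    rw [mul_one_div, div_le_div_iff₀ ht (by positivity)]
    linarith
  rw [cesaroMean_apply_eq hT h hτ, cesaroMean, ← mul_assoc, ← ENNReal.ofReal_ofNat 2,
    ← ENNReal.ofReal_mul zero_le_two]
  gcongr

theorem eventually_cesaroMean_le_apply (hT : IsC0Semigroup T) (h : H) {τ : ℝ} (hτ : 0 ≤ τ)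
    (hfin : ∫⁻ s in Set.Icc 0 τ, ‖applyOp C (T s h)‖ₑ ^ 2 ≠ ⊤) {δ : ENNReal} (hδ : 0 < δ) :
    ∀ᶠ t in atTop, cesaroMean C T h (t + τ) ≤ δ + cesaroMean C T (T τ h) t := by
  have initial_tendsto : Tendsto (fun t : ℝ => ENNReal.ofReal (1 / (t + τ)) *
      ∫⁻ s in Set.Icc 0 τ, ‖applyOp C (T s h)‖ₑ ^ 2) atTop (𝓝 0) := by
    have weight_tendsto : Tendsto (fun t : ℝ => 1 / (t + τ)) atTop (𝓝 0) :=
      tendsto_const_nhds.div_atTop (tendsto_atTop_add_const_right _ τ tendsto_id)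
    simpa using
      ENNReal.Tendsto.mul_const (ENNReal.tendsto_ofReal weight_tendsto) (Or.inr hfin)
  filter_upwards [initial_tendsto.eventually_le_const hδ, eventually_gt_atTop 0]
    with t initial_le ht
  have split : Set.Icc 0 (t + τ) ⊆ Set.Icc 0 τ ∪ Set.Icc τ (t + τ) := fun s hs =>
    (le_total s τ).imp (fun hsτ => ⟨hs.1, hsτ⟩) fun hτs => ⟨hτs, hs.2⟩
  have weight_le : 1 / (t + τ) ≤ 1 / t := one_div_le_one_div_of_le ht (by linarith)
  calc cesaroMean C T h (t + τ)
      ≤ ENNReal.ofReal (1 / (t + τ)) * ((∫⁻ s in Set.Icc 0 τ, ‖applyOp C (T s h)‖ₑ ^ 2) +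
          ∫⁻ s in Set.Icc τ (t + τ), ‖applyOp C (T s h)‖ₑ ^ 2) := by
        rw [cesaroMean]
        gcongr
        exact (lintegral_mono_set split).trans (lintegral_union_le _ _ _)
    _ ≤ δ + cesaroMean C T (T τ h) t := by
        rw [mul_add, cesaroMean_apply_eq hT h hτ]
        gcongr

theorem setLIntegral_ne_top_of_liminf_cesaroMean_ne_top {h : H}
    (hfin : liminf (cesaroMean C T h) atTop ≠ ⊤) (τ : ℝ) :
    ∫⁻ s in Set.Icc 0 τ, ‖applyOp C (T s h)‖ₑ ^ 2 ≠ ⊤ := by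
  obtain ⟨t, ht_lt, ht, hτt⟩ := ((frequently_lt_of_liminf_lt (by isBoundedDefault)
    (lt_top_iff_ne_top.2 hfin)).and_eventually
      ((eventually_gt_atTop 0).and (eventually_ge_atTop τ))).exists
  refine ne_top_of_le_ne_top (fun htop => ht_lt.ne ?_)
    (lintegral_mono_set (Set.Icc_subset_Icc_right hτt))
  rw [cesaroMean, htop, ENNReal.mul_top (by simpa using ht)]

/-- A generalized limit at `∞` of extended nonnegative functions which is invariant under
translation. Its purpose is to treat `limsup` and `liminf` at the same time. -/
structure IsShiftInvariantLimit (Φ : (ℝ → ENNReal) → ENNReal) : Prop where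
  mono : ∀ {u v}, (∀ᶠ t in atTop, u t ≤ v t) → Φ u ≤ Φ v
  comp_add_right : ∀ u (τ : ℝ), Φ (fun t => u (t + τ)) = Φ u
  add_mul : ∀ {a b : ENNReal} u, a ≠ ⊤ → b ≠ ⊤ → Φ (fun t => a + b * u t) = a + b * Φ u
  liminf_le : ∀ u, liminf u atTop ≤ Φ u

theorem monotone_add_mul (a b : ENNReal) : Monotone fun x : ENNReal => a + b * x :=
  fun _ _ hxy => by dsimp only; gcongr

theorem isShiftInvariantLimit_limsup : IsShiftInvariantLimit (limsup · atTop) where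
  mono huv := limsup_le_limsup huv
  comp_add_right u τ := by
    conv_rhs => rw [← (OrderIso.addRight τ).map_atTop]
    rfl
  add_mul {a b} u _ hb := ((monotone_add_mul a b).map_limsup_of_continuousAt u
    (continuous_const.add (ENNReal.continuous_const_mul hb)).continuousAt).symm
  liminf_le _ := liminf_le_limsup

theorem isShiftInvariantLimit_liminf : IsShiftInvariantLimit (liminf · atTop) where
  mono huv := liminf_le_liminf huv
  comp_add_right u τ := by
    conv_rhs => rw [← (OrderIso.addRight τ).map_atTop]
    rfl
  add_mul {a b} u _ hb := ((monotone_add_mul a b).map_liminf_of_continuousAt u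
    (continuous_const.add (ENNReal.continuous_const_mul hb)).continuousAt).symm
  liminf_le _ := le_rfl

namespace IsShiftInvariantLimit

variable {Φ : (ℝ → ENNReal) → ENNReal}

theorem cesaroMean_apply_le (hΦ : IsShiftInvariantLimit Φ) (hT : IsC0Semigroup T) (h : H) {τ : ℝ}
    (hτ : 0 ≤ τ) : Φ (cesaroMean C T (T τ h)) ≤ 2 * Φ (cesaroMean C T h) :=
  calc Φ (cesaroMean C T (T τ h)) ≤ Φ fun t => 0 + 2 * cesaroMean C T h (t + τ) :=
        hΦ.mono <| by simpa only [zero_add] using eventually_cesaroMean_apply_le hT h hτ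
    _ = 2 * Φ (cesaroMean C T h) := by
        rw [hΦ.add_mul (fun t => cesaroMean C T h (t + τ)) ENNReal.zero_ne_top
          ENNReal.ofNat_ne_top, hΦ.comp_add_right, zero_add]

theorem cesaroMean_le_apply (hΦ : IsShiftInvariantLimit Φ) (hT : IsC0Semigroup T) {h : H}
    (hfin : Φ (cesaroMean C T h) ≠ ⊤) {τ : ℝ} (hτ : 0 ≤ τ) :
    Φ (cesaroMean C T h) ≤ Φ (cesaroMean C T (T τ h)) := by
  have initial_ne_top := setLIntegral_ne_top_of_liminf_cesaroMean_ne_top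
    (ne_top_of_le_ne_top hfin (hΦ.liminf_le _)) τ
  refine ENNReal.le_of_forall_pos_le_add fun δ hδ _ => ?_
  calc Φ (cesaroMean C T h) = Φ fun t => cesaroMean C T h (t + τ) :=
        (hΦ.comp_add_right _ τ).symm
    _ ≤ Φ fun t => δ + 1 * cesaroMean C T (T τ h) t :=
        hΦ.mono <| by
          simpa only [one_mul] using eventually_cesaroMean_le_apply hT h hτ initial_ne_top
            (ENNReal.coe_pos.2 hδ)
    _ = Φ (cesaroMean C T (T τ h)) + δ := by
        rw [hΦ.add_mul _ ENNReal.coe_ne_top ENNReal.one_ne_top, one_mul, add_comm]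

variable {α β : ℝ}

theorem mul_norm_apply_sq_le (hΦ : IsShiftInvariantLimit Φ) (hT : IsC0Semigroup T)
    (hC : IsSemigroupWeight C T) (hβ : 0 ≤ β)
    (bounds : ∀ h ∈ C.domain, ENNReal.ofReal (α * ‖h‖ ^ 2) ≤ Φ (cesaroMean C T h) ∧
      Φ (cesaroMean C T h) ≤ ENNReal.ofReal (β * ‖h‖ ^ 2)) {t : ℝ} (ht : 0 ≤ t) (h : H) :
    α * ‖T t h‖ ^ 2 ≤ 2 * (β * ‖h‖ ^ 2) := by
  have closed : IsClosed {h | α * ‖T t h‖ ^ 2 ≤ 2 * (β * ‖h‖ ^ 2)} :=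
    isClosed_le (by fun_prop) (by fun_prop)
  refine closed.closure_subset_iff.2 (fun x hx => ?_) (hC.dense h)
  refine (ENNReal.ofReal_le_ofReal_iff (by positivity)).1 ?_
  rw [ENNReal.ofReal_mul zero_le_two, ENNReal.ofReal_ofNat]
  calc _ ≤ Φ (cesaroMean C T (T t x)) := (bounds _ (hC.invariant t ht x hx)).1
    _ ≤ 2 * Φ (cesaroMean C T x) := hΦ.cesaroMean_apply_le hT x ht
    _ ≤ _ := by
        gcongr
        exact (bounds x hx).2

theorem mul_norm_sq_le (hΦ : IsShiftInvariantLimit Φ) (hT : IsC0Semigroup T)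
    (hC : IsSemigroupWeight C T) (hβ : 0 ≤ β)
    (bounds : ∀ h ∈ C.domain, ENNReal.ofReal (α * ‖h‖ ^ 2) ≤ Φ (cesaroMean C T h) ∧
      Φ (cesaroMean C T h) ≤ ENNReal.ofReal (β * ‖h‖ ^ 2)) {t : ℝ} (ht : 0 ≤ t) (h : H) :
    α * ‖h‖ ^ 2 ≤ β * ‖T t h‖ ^ 2 := by
  have closed : IsClosed {h | α * ‖h‖ ^ 2 ≤ β * ‖T t h‖ ^ 2} :=
    isClosed_le (by fun_prop) (by fun_prop)
  refine closed.closure_subset_iff.2 (fun x hx => ?_) (hC.dense h)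
  refine (ENNReal.ofReal_le_ofReal_iff (by positivity)).1 ?_
  calc _ ≤ Φ (cesaroMean C T x) := (bounds x hx).1
    _ ≤ Φ (cesaroMean C T (T t x)) :=
        hΦ.cesaroMean_le_apply hT (ne_top_of_le_ne_top ENNReal.ofReal_ne_top (bounds x hx).2) ht
    _ ≤ _ := (bounds _ (hC.invariant t ht x hx)).2

theorem isSimilarToIsometricSemigroup [CompleteSpace H] (hΦ : IsShiftInvariantLimit Φ)
    (hT : IsC0Semigroup T) (hC : IsSemigroupWeight C T) (hα : 0 < α) (hβ : 0 < β)
    (bounds : ∀ h ∈ C.domain, ENNReal.ofReal (α * ‖h‖ ^ 2) ≤ Φ (cesaroMean C T h) ∧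
      Φ (cesaroMean C T h) ≤ ENNReal.ofReal (β * ‖h‖ ^ 2)) :
    IsSimilarToIsometricSemigroup T := by
  have upper t (ht : 0 ≤ t) : ‖T t‖ ≤ √(2 * β / α) := by
    refine (T t).opNorm_le_bound (Real.sqrt_nonneg _) fun x => ?_
    rw [← pow_le_pow_iff_left₀ (norm_nonneg _) (by positivity) two_ne_zero, mul_pow,
      Real.sq_sqrt (by positivity), div_mul_eq_mul_div, le_div_iff₀' hα, mul_assoc]
    exact hΦ.mul_norm_apply_sq_le hT hC hβ.le bounds ht x
  have lower t (ht : 0 ≤ t) x : √(α / β) * ‖x‖ ≤ ‖T t x‖ := by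
    rw [← pow_le_pow_iff_left₀ (by positivity) (norm_nonneg _) two_ne_zero, mul_pow,
      Real.sq_sqrt (by positivity), div_mul_eq_mul_div, div_le_iff₀' hβ]
    exact hΦ.mul_norm_sq_le hT hC hβ.le bounds ht x
  exact IsBoundedC0Semigroup.isSimilarToIsometricSemigroup ⟨hT, upper⟩ (by positivity) lower

end IsShiftInvariantLimit

end WeightedCesaroMeans

section IdentityWeight

variable {H : Type u} [NormedAddCommGroup H] [InnerProductSpace ℂ H]

/-- The identity of `H` as an everywhere defined operator: the unit weight. -/
noncomputable def idPMap (H : Type u) [NormedAddCommGroup H] [InnerProductSpace ℂ H] :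
    H →ₗ.[ℂ] H :=
  (LinearMap.id : H →ₗ[ℂ] H).toPMap ⊤

theorem applyOp_idPMap (x : H) : applyOp (idPMap H) x = x :=
  dif_pos (Submodule.mem_top : x ∈ (idPMap H).domain)

variable {T : ℝ → H →L[ℂ] H} {m M : ℝ}

theorem IsBoundedC0Semigroup.isSemigroupWeight_idPMap (hT : IsBoundedC0Semigroup T M) :
    IsSemigroupWeight (idPMap H) T where
  dense := dense_univ
  invariant _ _ _ _ := Submodule.mem_top
  measurable h _ := by
    simp_rw [applyOp_idPMap]
    exact (hT.continuousOn_orbit h).aestronglyMeasurable measurableSet_Ici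

theorem IsBoundedC0Semigroup.cesaroMean_idPMap_le (hT : IsBoundedC0Semigroup T M) (h : H) {t : ℝ}
    (ht : 0 < t) : cesaroMean (idPMap H) T h t ≤ ENNReal.ofReal (M ^ 2 * ‖h‖ ^ 2) := by
  have := isProbabilityMeasure_uniformMeasure ht
  simp_rw [cesaroMean_eq_lintegral, applyOp_idPMap, ← mul_pow]
  exact lintegral_enorm_sq_le ((ae_uniformMeasure_nonneg t).mono fun s hs => hT.norm_apply_le hs h)

theorem le_cesaroMean_idPMap (hm : 0 ≤ m) {h : H} (hmT : ∀ t, 0 ≤ t → m * ‖h‖ ≤ ‖T t h‖) {t : ℝ}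
    (ht : 0 < t) : ENNReal.ofReal (m ^ 2 * ‖h‖ ^ 2) ≤ cesaroMean (idPMap H) T h t := by
  have := isProbabilityMeasure_uniformMeasure ht
  simp_rw [cesaroMean_eq_lintegral, applyOp_idPMap, ← mul_pow]
  exact le_lintegral_enorm_sq (by positivity) ((ae_uniformMeasure_nonneg t).mono hmT)

end IdentityWeight

section Skew

variable {H : Type u} [NormedAddCommGroup H] [InnerProductSpace ℂ H]

/-- The operator `E` is skew-symmetric for the form `⟨Q x, y⟩`; for symmetric `Q` the real part on
the diagonal decides this. -/
def IsSkewFor (Q : H →L[ℂ] H) (E : H →ₗ.[ℂ] H) : Prop :=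
  ∀ x : E.domain, (inner ℂ (Q (E x)) (x : H)).re = 0

variable {Q : H →L[ℂ] H} {E : H →ₗ.[ℂ] H} {R : H →L[ℂ] H} {T : ℝ → H →L[ℂ] H} {m M : ℝ}

theorem IsGeneratorOf.map_mem_graph (hET : IsGeneratorOf E T) (hT : IsC0Semigroup T) {x y : H}
    (hxy : (x, y) ∈ E.graph) {t : ℝ} (ht : 0 ≤ t) : (T t x, T t y) ∈ E.graph := by
  rw [hT.isGeneratorOf_iff.1 hET] at hxy ⊢
  refine (((T t).restrictScalars ℝ).hasFDerivAt.comp_hasDerivWithinAt 0 hxy).congr_of_mem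
    (fun s hs => ?_) Set.self_mem_Ici
  rw [← hT.apply_add hs ht, add_comm, hT.apply_add ht hs]
  rfl

namespace IsSkewFor

theorem re_inner_apply (hE : IsSkewFor Q E) (hQ : Q.IsSymmetric) (x : E.domain) :
    (inner ℂ (Q (x : H)) (E x)).re = 0 := by
  rw [← inner_conj_symm, Complex.conj_re, ← hE x]
  exact congrArg Complex.re (hQ (E x) x).symm

theorem reApplyInnerSelf_smul_sub (hE : IsSkewFor Q E) (hQ : Q.IsSymmetric) (r : ℝ)
    (x : E.domain) : Q.reApplyInnerSelf ((r : ℂ) • (x : H) - E x) =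
      r ^ 2 * Q.reApplyInnerSelf x + Q.reApplyInnerSelf (E x) := by
  simp only [ContinuousLinearMap.reApplyInnerSelf_apply, map_sub, map_smul, inner_sub_left,
    inner_sub_right, inner_smul_left, inner_smul_right, Complex.conj_ofReal, RCLike.re_to_complex,
    Complex.sub_re, Complex.re_ofReal_mul, hE x, hE.re_inner_apply hQ x]
  ring

theorem reApplyInnerSelf_smul_resolvent_le (hE : IsSkewFor Q E) (hQ : Q.IsPositive) {r : ℝ}
    (hR : IsResolventAt E r R) (y : H) :
    Q.reApplyInnerSelf ((r • R) y) ≤ Q.reApplyInnerSelf y := by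
  obtain ⟨hy, hRy⟩ := hR.right_inv y
  calc Q.reApplyInnerSelf ((r • R) y) = r ^ 2 * Q.reApplyInnerSelf (R y) := by
        rw [smul_apply, ← Complex.coe_smul, ContinuousLinearMap.reApplyInnerSelf_smul,
          Complex.norm_real, Real.norm_eq_abs, sq_abs]
    _ ≤ r ^ 2 * Q.reApplyInnerSelf (R y) + Q.reApplyInnerSelf (E ⟨R y, hy⟩) :=
        le_add_of_nonneg_right (hQ.2 _)
    _ = Q.reApplyInnerSelf y := by
        rw [← hE.reApplyInnerSelf_smul_sub hQ.isSymmetric r ⟨R y, hy⟩, hRy]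

theorem reApplyInnerSelf_pow_smul_resolvent_le (hE : IsSkewFor Q E) (hQ : Q.IsPositive) {r : ℝ}
    (hR : IsResolventAt E r R) (k : ℕ) (y : H) :
    Q.reApplyInnerSelf (((r • R) ^ k) y) ≤ Q.reApplyInnerSelf y := by
  induction k with
  | zero => rfl
  | succ k ih =>
    rw [pow_succ']
    exact (hE.reApplyInnerSelf_smul_resolvent_le hQ hR _).trans ih

theorem reApplyInnerSelf_orbit_eq (hE : IsSkewFor Q E) (hQ : Q.IsSymmetric)
    (hT : IsBoundedC0Semigroup T M) (hET : IsGeneratorOf E T) (x : E.domain) {t : ℝ}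
    (ht : 0 ≤ t) : Q.reApplyInnerSelf (T t x) = Q.reApplyInnerSelf x := by
  have deriv_orbit s (hs : 0 ≤ s) (z : E.domain) :
      HasDerivWithinAt (fun t => T t (z : H)) (T s (E z)) (Set.Ici s) s :=
    hT.hasDerivWithinAt_orbit ((hT.isGeneratorOf_iff.1 hET _ _).1 (E.mem_graph z)) hs
  have constant := constant_of_has_deriv_right_zero
    (f := fun s => Q.reApplyInnerSelf (T s x)) (a := 0) (b := t)
    (Q.reApplyInnerSelf_continuous.comp_continuousOn
      ((hT.continuousOn_orbit x).mono Set.Icc_subset_Ici_self)) fun s hs => by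
        obtain ⟨y, hy, hEy⟩ := (LinearPMap.mem_graph_iff E).1 <|
          hET.map_mem_graph hT.toIsC0Semigroup (E.mem_graph x) hs.1
        have deriv_Q := (Q.restrictScalars ℝ).hasFDerivAt.comp_hasDerivWithinAt s
          (deriv_orbit s hs.1 x)
        refine (Complex.reCLM.hasFDerivAt.comp_hasDerivWithinAt s
          (deriv_Q.inner ℂ (deriv_orbit s hs.1 x))).congr_deriv ?_
        have skew_left := hE y
        have skew_right := hE.re_inner_apply hQ y
        rw [hy, hEy] at skew_left skew_right
        simp [skew_left, skew_right]
  simpa [hT.map_zero] using constant t ⟨ht, le_rfl⟩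

variable [CompleteSpace H]

theorem dense_domain (hE : IsSkewFor Q E) (hQ : Q.IsSymmetric) (hm : 0 < m)
    (hQm : ∀ x, m * ‖x‖ ^ 2 ≤ Q.reApplyInnerSelf x) (hR : IsResolventAt E 1 R) :
    Dense (E.domain : Set H) := by
  rw [Submodule.dense_iff_topologicalClosure_eq_top, Submodule.topologicalClosure_eq_top_iff,
    Submodule.eq_bot_iff]
  intro v hv
  obtain ⟨u, rfl⟩ := (ContinuousLinearMap.isUnit_iff_bijective.1
    (isUnit_of_le_reApplyInnerSelf hm hQm)).2 v
  obtain ⟨hRu, hu⟩ := hR.right_inv u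
  set x : E.domain := ⟨R u, hRu⟩
  have orthogonal : inner ℂ (Q (x : H)) u = 0 :=
    (hQ x u).trans ((Submodule.mem_orthogonal _ _).1 hv x x.2)
  have form_zero : Q.reApplyInnerSelf (x : H) = 0 := by
    have := congrArg Complex.re orthogonal
    rwa [← hu, one_smul, inner_sub_right, Complex.sub_re, hE.re_inner_apply hQ, sub_zero] at this
  have x_zero : x = 0 := by
    have := nonpos_of_mul_nonpos_right ((hQm x).trans_eq form_zero) hm
    simpa using this
  rw [← hu, one_smul, show R u = (x : H) from rfl, x_zero]
  simp

theorem exists_isSimilarToIsometricSemigroup (hE : IsSkewFor Q E) (hQ : Q.IsPositive)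
    (hm : 0 < m) (hQm : ∀ x, m * ‖x‖ ^ 2 ≤ Q.reApplyInnerSelf x) {R : ℝ → H →L[ℂ] H}
    (hR : ∀ r : ℝ, 0 < r → IsResolventAt E r (R r)) :
    ∃ T, IsC0Semigroup T ∧ IsGeneratorOf E T ∧ IsSimilarToIsometricSemigroup T := by
  have norm_le x y (hxy : Q.reApplyInnerSelf y ≤ Q.reApplyInnerSelf x) :
      ‖y‖ ≤ √(‖Q‖ / m) * ‖x‖ := by
    refine le_of_sq_le_sq ?_ (by positivity)
    rw [mul_pow, Real.sq_sqrt (by positivity), div_mul_eq_mul_div, le_div_iff₀' hm]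
    calc m * ‖y‖ ^ 2 ≤ Q.reApplyInnerSelf x := (hQm y).trans hxy
      _ ≤ ‖Q x‖ * ‖x‖ := re_inner_le_norm _ _
      _ ≤ ‖Q‖ * ‖x‖ ^ 2 := by
          rw [sq, ← mul_assoc]
          gcongr
          exact Q.le_opNorm x
  have dense : Dense (E.domain : Set H) :=
    hE.dense_domain hQ.isSymmetric hm hQm (by simpa using hR 1 one_pos)
  obtain ⟨T, hT, hET⟩ := exists_isBoundedC0Semigroup_of_norm_resolvent_pow_le dense hR
    fun r hr k => ContinuousLinearMap.opNorm_le_bound _ (Real.sqrt_nonneg (‖Q‖ / m)) fun x =>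
      norm_le x _ (hE.reApplyInnerSelf_pow_smul_resolvent_le hQ (hR r hr) k x)
  refine ⟨T, hT.toIsC0Semigroup, hET, hT.isSimilarToIsometricSemigroup_of_isPositive hQ
    (isUnit_of_le_reApplyInnerSelf hm hQm) fun t ht => ?_⟩
  refine congrFun (Continuous.ext_on dense (Q.reApplyInnerSelf_continuous.comp (T t).continuous)
    Q.reApplyInnerSelf_continuous fun x hx => ?_)
  exact hE.reApplyInnerSelf_orbit_eq hQ.isSymmetric hT hET ⟨x, hx⟩ ht

end IsSkewFor

end Skew

section ResolventMeans

section

variable {K : Type*} [NormedAddCommGroup K] [InnerProductSpace ℂ K]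

-- Pairing `c` with `(1 + z) φ = ψ + φ + c` instead of `z φ = ψ + c` avoids the singularity of
-- `z⁻¹ c` on the imaginary axis; here `c` is written as `conj (1 + z) • g`.
theorem re_inner_eq_of_smul_eq {z : ℂ} {φ ψ g : K} (h : z • φ = ψ + starRingEnd ℂ (1 + z) • g) :
    (inner ℂ ψ φ).re =
      z.re * ‖φ‖ ^ 2 - (inner ℂ g (ψ + φ)).re - (1 + z.re) * ‖g‖ ^ 2 := by
  have self (x : K) : inner ℂ x x = ((‖x‖ ^ 2 : ℝ) : ℂ) := by
    rw [inner_self_eq_norm_sq_to_K, Complex.ofReal_pow]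
    rfl
  have inner_eq : inner ℂ ψ φ = starRingEnd ℂ z * ((‖φ‖ ^ 2 : ℝ) : ℂ) - (inner ℂ g (ψ + φ)
      + starRingEnd ℂ (1 + z) * ((‖g‖ ^ 2 : ℝ) : ℂ)) :=
    calc inner ℂ ψ φ = inner ℂ (z • φ - starRingEnd ℂ (1 + z) • g) φ := by
          rw [h, add_sub_cancel_right]
      _ = starRingEnd ℂ z * inner ℂ φ φ - inner ℂ g (φ + z • φ) := by
          rw [inner_sub_left, inner_smul_left, inner_smul_left, Complex.conj_conj,
            inner_add_right, inner_smul_right, add_mul, one_mul]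
      _ = _ := by
          rw [h, ← add_assoc, add_comm φ ψ, inner_add_right, inner_smul_right, self, self]
  rw [inner_eq]
  simp only [Complex.sub_re, Complex.add_re, Complex.re_mul_ofReal, Complex.conj_re,
    Complex.one_re]
  ring

theorem re_integral_inner_eq_of_smul_eq {α : Type*} [MeasurableSpace α] {μ : Measure α}
    {z : α → ℂ} {r : ℝ} (hz : ∀ a, (z a).re = r) {φ ψ g : α → K} (hφ : MemLp φ 2 μ)
    (hψ : MemLp ψ 2 μ) (hg : MemLp g 2 μ)
    (h : ∀ a, z a • φ a = ψ a + starRingEnd ℂ (1 + z a) • g a) :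
    (∫ a, inner ℂ (ψ a) (φ a) ∂μ).re = r * ∫ a, ‖φ a‖ ^ 2 ∂μ
      - (∫ a, inner ℂ (g a) ((ψ + φ) a) ∂μ).re - (1 + r) * ∫ a, ‖g a‖ ^ 2 ∂μ := by
  have integrable_sq {f : α → K} (hf : MemLp f 2 μ) : Integrable (fun a => ‖f a‖ ^ 2) μ :=
    (memLp_two_iff_integrable_sq_norm hf.1).1 hf
  have integrable_cross : Integrable (fun a => (inner ℂ (g a) ((ψ + φ) a)).re) μ :=
    (integrable_inner_of_memLp hg (hψ.add hφ)).re
  have integrable_diff :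
      Integrable (fun a => r * ‖φ a‖ ^ 2 - (inner ℂ (g a) ((ψ + φ) a)).re) μ :=
    ((integrable_sq hφ).const_mul r).sub integrable_cross
  have re_integral {u v : α → K} (hu : MemLp u 2 μ) (hv : MemLp v 2 μ) :
      (∫ a, inner ℂ (u a) (v a) ∂μ).re = ∫ a, (inner ℂ (u a) (v a)).re ∂μ :=
    (integral_re (integrable_inner_of_memLp hu hv)).symm
  rw [re_integral hψ hφ, re_integral hg (hψ.add hφ), ← integral_const_mul, ← integral_const_mul,
    ← integral_sub ((integrable_sq hφ).const_mul r) integrable_cross,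
    ← integral_sub integrable_diff ((integrable_sq hg).const_mul _)]
  exact integral_congr_ae (Eventually.of_forall fun a => by
    simpa only [hz a, Pi.add_apply] using re_inner_eq_of_smul_eq (h a))

theorem one_add_sq_le_normSq {ε : ℝ} (hε : 0 ≤ ε) (ξ : ℝ) :
    1 + ξ ^ 2 ≤ Complex.normSq (1 + ((ε : ℂ) + (ξ : ℂ) * Complex.I)) := by
  simp only [Complex.normSq_apply, Complex.add_re, Complex.one_re, Complex.ofReal_re,
    Complex.re_ofReal_mul, Complex.I_re, Complex.add_im, Complex.one_im, Complex.ofReal_im,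
    Complex.im_ofReal_mul, Complex.I_im]
  nlinarith

theorem norm_inv_smul_sq_le {ε : ℝ} (hε : 0 ≤ ε) (c : K) (ξ : ℝ) :
    ‖(starRingEnd ℂ (1 + ((ε : ℂ) + (ξ : ℂ) * Complex.I)))⁻¹ • c‖ ^ 2
      ≤ (1 + ξ ^ 2)⁻¹ * ‖c‖ ^ 2 := by
  rw [norm_smul, norm_inv, RCLike.norm_conj, mul_pow, inv_pow, ← Complex.normSq_eq_norm_sq]
  gcongr
  exact one_add_sq_le_normSq hε ξ

theorem memLp_inv_smul {ε : ℝ} (hε : 0 ≤ ε) (c : K) :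
    MemLp (fun ξ : ℝ => (starRingEnd ℂ (1 + ((ε : ℂ) + (ξ : ℂ) * Complex.I)))⁻¹ • c) 2 := by
  have measurable : AEStronglyMeasurable fun ξ : ℝ =>
      (starRingEnd ℂ (1 + ((ε : ℂ) + (ξ : ℂ) * Complex.I)))⁻¹ • c := by
    fun_prop
  refine (memLp_two_iff_integrable_sq_norm measurable).2
    ((integrable_inv_one_add_sq.mul_const (‖c‖ ^ 2)).mono' (by fun_prop)
      (Eventually.of_forall fun ξ => ?_))
  rw [Real.norm_of_nonneg (sq_nonneg _)]
  exact norm_inv_smul_sq_le hε c ξ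

theorem integral_norm_inv_smul_sq_le {ε : ℝ} (hε : 0 ≤ ε) (c : K) :
    ∫ ξ : ℝ, ‖(starRingEnd ℂ (1 + ((ε : ℂ) + (ξ : ℂ) * Complex.I)))⁻¹ • c‖ ^ 2
      ≤ Real.pi * ‖c‖ ^ 2 := by
  rw [← integral_univ_inv_one_add_sq, ← integral_mul_const]
  exact integral_mono_of_nonneg (Eventually.of_forall fun ξ => sq_nonneg _)
    (integrable_inv_one_add_sq.mul_const _) (Eventually.of_forall (norm_inv_smul_sq_le hε c))

theorem abs_re_integral_inner_le_of_smul_eq {ε : ℝ} (hε : 0 ≤ ε) {φ ψ : ℝ → K} {c : K}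
    (hφ : MemLp φ 2 (ENNReal.ofReal ε • volume)) (hψ : MemLp ψ 2 (ENNReal.ofReal ε • volume))
    (h : ∀ ξ : ℝ, ((ε : ℂ) + (ξ : ℂ) * Complex.I) • φ ξ = ψ ξ + c) :
    |(∫ ξ, inner ℂ (ψ ξ) (φ ξ) ∂(ENNReal.ofReal ε • volume)).re| ≤
      ε * ∫ ξ, ‖φ ξ‖ ^ 2 ∂(ENNReal.ofReal ε • volume)
        + √(ε * (Real.pi * ‖c‖ ^ 2)) * √(∫ ξ, ‖(ψ + φ) ξ‖ ^ 2 ∂(ENNReal.ofReal ε • volume))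
        + (1 + ε) * (ε * (Real.pi * ‖c‖ ^ 2)) := by
  set μ : Measure ℝ := ENNReal.ofReal ε • volume
  let g (ξ : ℝ) : K := (starRingEnd ℂ (1 + ((ε : ℂ) + (ξ : ℂ) * Complex.I)))⁻¹ • c
  have hg : MemLp g 2 μ := (memLp_inv_smul hε c).smul_measure ENNReal.ofReal_ne_top
  have g_le : ∫ ξ, ‖g ξ‖ ^ 2 ∂μ ≤ ε * (Real.pi * ‖c‖ ^ 2) := by
    rw [integral_smul_measure, ENNReal.toReal_ofReal hε, smul_eq_mul]
    gcongr
    exact integral_norm_inv_smul_sq_le hε c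
  have smul_g (ξ : ℝ) : starRingEnd ℂ (1 + ((ε : ℂ) + (ξ : ℂ) * Complex.I)) • g ξ = c := by
    refine smul_inv_smul₀ ((map_ne_zero _).2 (Complex.normSq_pos.1 ?_)) c
    exact (by positivity : 0 < 1 + ξ ^ 2).trans_le (one_add_sq_le_normSq hε ξ)
  have cross_le : |(∫ ξ, inner ℂ (g ξ) ((ψ + φ) ξ) ∂μ).re| ≤
      √(ε * (Real.pi * ‖c‖ ^ 2)) * √(∫ ξ, ‖(ψ + φ) ξ‖ ^ 2 ∂μ) :=
    (Complex.abs_re_le_norm _).trans <| (norm_integral_inner_le hg (hψ.add hφ)).trans <| by gcongr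
  have φ_nonneg : 0 ≤ ∫ ξ, ‖φ ξ‖ ^ 2 ∂μ := integral_nonneg fun _ => sq_nonneg _
  have g_nonneg : 0 ≤ ∫ ξ, ‖g ξ‖ ^ 2 ∂μ := integral_nonneg fun _ => sq_nonneg _
  rw [re_integral_inner_eq_of_smul_eq (z := fun ξ : ℝ => (ε : ℂ) + (ξ : ℂ) * Complex.I) (r := ε)
    (by simp) hφ hψ hg fun ξ => by rw [smul_g, h]]
  calc _ ≤ |ε * ∫ ξ, ‖φ ξ‖ ^ 2 ∂μ| + |(∫ ξ, inner ℂ (g ξ) ((ψ + φ) ξ) ∂μ).re|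
        + |(1 + ε) * ∫ ξ, ‖g ξ‖ ^ 2 ∂μ| := (abs_sub _ _).trans (by gcongr; exact abs_sub _ _)
    _ ≤ _ := by
      rw [abs_of_nonneg (mul_nonneg hε φ_nonneg),
        abs_of_nonneg (mul_nonneg (by positivity) g_nonneg)]
      exact add_le_add (add_le_add le_rfl cross_le)
        (mul_le_mul_of_nonneg_left g_le (by positivity))

end

variable {H : Type u} [NormedAddCommGroup H] [InnerProductSpace ℂ H]
variable {K : Type u} [NormedAddCommGroup K] [InnerProductSpace ℂ K]
variable {C : H →ₗ.[ℂ] K} {E : H →ₗ.[ℂ] H}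

theorem applyOp_of_mem {x : H} (hx : x ∈ C.domain) : applyOp C x = C ⟨x, hx⟩ := dif_pos hx

theorem operatorResolvent_mem_domain (E : H →ₗ.[ℂ] H) (z : ℂ) (x : H) :
    operatorResolvent E z x ∈ E.domain := by
  by_cases hz : z ∈ operatorResolventSet E
  · exact (isResolventAt_operatorResolvent hz).mem_domain x
  · rw [operatorResolvent, dif_neg (show ¬∃ R, IsResolventAt E z R from hz)]
    exact E.domain.zero_mem

/-- The map `h ↦ (ξ ↦ C (ε + iξ - E)⁻¹ h)`. -/
noncomputable def weightedResolvent (hEC : E.domain ≤ C.domain) (ε : ℝ) : H →ₗ[ℂ] ℝ → K :=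
  LinearMap.pi fun ξ => C.toFun ∘ₗ
    (operatorResolvent E ((ε : ℂ) + (ξ : ℂ) * Complex.I) : H →ₗ[ℂ] H).codRestrict C.domain
      fun h => hEC (operatorResolvent_mem_domain E _ h)

theorem weightedResolvent_apply (hEC : E.domain ≤ C.domain) (ε : ℝ) (h : H) (ξ : ℝ) :
    weightedResolvent hEC ε h ξ =
      applyOp C (operatorResolvent E ((ε : ℂ) + (ξ : ℂ) * Complex.I) h) :=
  (applyOp_of_mem _).symm

theorem smul_weightedResolvent_apply (hEC : E.domain ≤ C.domain) {ε ξ : ℝ}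
    (hz : (ε : ℂ) + (ξ : ℂ) * Complex.I ∈ operatorResolventSet E) (x : E.domain) :
    ((ε : ℂ) + (ξ : ℂ) * Complex.I) • weightedResolvent hEC ε x ξ =
      weightedResolvent hEC ε (E x) ξ + C ⟨x, hEC x.2⟩ := by
  set z : ℂ := (ε : ℂ) + (ξ : ℂ) * Complex.I
  have mem_C y : operatorResolvent E z y ∈ C.domain := hEC (operatorResolvent_mem_domain E z y)
  have resolvent_eq : z • (⟨_, mem_C x⟩ : C.domain) = ⟨_, mem_C (E x)⟩ + ⟨x, hEC x.2⟩ :=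
    Subtype.ext <| eq_add_of_sub_eq
      ((isResolventAt_operatorResolvent hz).apply_map x).symm
  rw [weightedResolvent_apply, weightedResolvent_apply, applyOp_of_mem (mem_C _),
    applyOp_of_mem (mem_C _), ← C.map_smul, resolvent_eq, C.map_add]

theorem resolventMean_eq_lintegral (hEC : E.domain ≤ C.domain) (h : H) (ε : ℝ) :
    resolventMean C E h ε =
      ∫⁻ ξ, ‖weightedResolvent hEC ε h ξ‖ₑ ^ 2 ∂(ENNReal.ofReal ε • volume) := by
  rw [lintegral_smul_measure]
  simp only [weightedResolvent_apply, resolventMean, smul_eq_mul]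

theorem isSkewFor_of_isGramOperator_weightedResolvent (hEC : E.domain ≤ C.domain)
    (hE : ∀ z : ℂ, 0 < z.re → z ∈ operatorResolventSet E) {𝒰 : Ultrafilter ℝ}
    (h𝒰 : (𝒰 : Filter ℝ) ≤ 𝓝[>] 0) {Q : H →L[ℂ] H}
    (hQ : IsGramOperator 𝒰 (fun ε => ENNReal.ofReal ε • volume) (weightedResolvent hEC) Q) :
    IsSkewFor Q E := by
  intro x
  set c : K := C ⟨x, hEC x.2⟩
  have tendsto_id : Tendsto (fun ε : ℝ => ε) 𝒰 (𝓝 0) := h𝒰.trans nhdsWithin_le_nhds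
  have tendsto_tail : Tendsto (fun ε : ℝ => ε * (Real.pi * ‖c‖ ^ 2)) 𝒰 (𝓝 0) := by
    simpa using tendsto_id.mul_const (Real.pi * ‖c‖ ^ 2)
  have tendsto_bound := ((tendsto_id.mul (hQ.tendsto_integral_norm_sq x)).add
    (tendsto_tail.sqrt.mul (hQ.tendsto_integral_norm_sq (E x + x)).sqrt)).add
    ((tendsto_id.const_add 1).mul tendsto_tail)
  rw [Real.sqrt_zero, zero_mul, zero_mul, mul_zero, add_zero, add_zero] at tendsto_bound
  refine abs_nonpos_iff.1 (le_of_tendsto_of_tendsto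
    ((Complex.continuous_re.tendsto _).comp (hQ.tendsto_inner (E x) x)).abs tendsto_bound ?_)
  filter_upwards [h𝒰 self_mem_nhdsWithin, hQ.memLp (x : H), hQ.memLp (E x)] with ε hε hx hEx
  rw [map_add]
  exact abs_re_integral_inner_le_of_smul_eq (le_of_lt hε) hx hEx fun ξ =>
    smul_weightedResolvent_apply hEC (hE _ (by simpa using hε)) x

theorem eventually_resolventMean_le (hEC : E.domain ≤ C.domain) {β : ℝ} (hβ : 0 < β) {h : H}
    (hlim : limsup (resolventMean C E h) (𝓝[>] 0) ≤ ENNReal.ofReal (β * ‖h‖ ^ 2)) :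
    ∀ᶠ ε in 𝓝[>] 0, resolventMean C E h ε ≤ ENNReal.ofReal (2 * β * ‖h‖ ^ 2) := by
  rcases eq_or_ne h 0 with rfl | hh
  · simp [resolventMean_eq_lintegral hEC]
  · have : 0 < β * ‖h‖ ^ 2 := by positivity
    exact (eventually_lt_of_limsup_lt (hlim.trans_lt
      ((ENNReal.ofReal_lt_ofReal_iff (by positivity)).2 (by linarith)))).mono fun _ => le_of_lt

theorem eventually_le_resolventMean {α : ℝ} (hα : 0 < α) {h : H}
    (hlim : ENNReal.ofReal (α * ‖h‖ ^ 2) ≤ liminf (resolventMean C E h) (𝓝[>] 0)) :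
    ∀ᶠ ε in 𝓝[>] 0, ENNReal.ofReal (α / 2 * ‖h‖ ^ 2) ≤ resolventMean C E h ε := by
  rcases eq_or_ne h 0 with rfl | hh
  · simp
  · have : 0 < α * ‖h‖ ^ 2 := by positivity
    exact (eventually_lt_of_lt_liminf (((ENNReal.ofReal_lt_ofReal_iff this).2
      (by linarith)).trans_le hlim)).mono fun _ => le_of_lt

theorem IsResolventWeight.exists_isSimilarToIsometricSemigroup [CompleteSpace H]
    (hC : IsResolventWeight C E) (hE : ∀ z : ℂ, 0 < z.re → z ∈ operatorResolventSet E)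
    {α β : ℝ} (hα : 0 < α) (hβ : 0 < β)
    (upper : ∀ h, limsup (resolventMean C E h) (𝓝[>] 0) ≤ ENNReal.ofReal (β * ‖h‖ ^ 2))
    (lower : ∀ h, ENNReal.ofReal (α * ‖h‖ ^ 2) ≤ liminf (resolventMean C E h) (𝓝[>] 0)) :
    ∃ T, IsC0Semigroup T ∧ IsGeneratorOf E T ∧ IsSimilarToIsometricSemigroup T := by
  let 𝒰 : Ultrafilter ℝ := Ultrafilter.of (𝓝[>] 0)
  have h𝒰 : (𝒰 : Filter ℝ) ≤ 𝓝[>] 0 := Ultrafilter.of_le _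
  obtain ⟨Q, hQ⟩ := exists_isGramOperator 𝒰 (μ := fun ε => ENNReal.ofReal ε • volume)
    (F := weightedResolvent hC.domain_le) (Real.sqrt_nonneg (2 * β))
    (fun h => by
      filter_upwards [h𝒰 self_mem_nhdsWithin] with ε hε
      have := (hC.measurable ε hε h).smul_measure (ENNReal.ofReal ε)
      simpa only [← weightedResolvent_apply hC.domain_le] using this)
    (fun h => by
      filter_upwards [h𝒰 (eventually_resolventMean_le hC.domain_le hβ (upper h))] with ε hε
      rwa [← resolventMean_eq_lintegral, mul_pow, Real.sq_sqrt (by positivity)])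
  have le_Q h : α / 2 * ‖h‖ ^ 2 ≤ Q.reApplyInnerSelf h := by
    refine ge_of_tendsto (hQ.tendsto_integral_norm_sq h) ?_
    filter_upwards [h𝒰 (eventually_le_resolventMean hα (lower h)), hQ.memLp h] with ε hε hmem
    rwa [resolventMean_eq_lintegral hC.domain_le, ← ofReal_integral_norm_sq hmem,
      ENNReal.ofReal_le_ofReal_iff (integral_nonneg fun _ => sq_nonneg _)] at hε
  exact (isSkewFor_of_isGramOperator_weightedResolvent hC.domain_le hE h𝒰
    hQ).exists_isSimilarToIsometricSemigroup hQ.isPositive (half_pos hα) le_Q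
    fun r hr => isResolventAt_operatorResolvent (hE r (by simpa using hr))

end ResolventMeans

section Plancherel

open FourierTransform SchwartzMap

variable {V F : Type*} [NormedAddCommGroup V] [InnerProductSpace ℝ V] [MeasurableSpace V]
  [BorelSpace V] [FiniteDimensional ℝ V] [NormedAddCommGroup F] [InnerProductSpace ℂ F]

theorem continuous_fourier_of_integrable {f : V → F} (hf : Integrable f) : Continuous (𝓕 f) :=
  VectorFourier.fourierIntegral_continuous Real.continuous_fourierChar
    (continuous_inner (𝕜 := ℝ)) hf

variable [CompleteSpace F]

theorem integral_smul_fourier_toLp {f : V → F} (hf : Integrable f) (hf_two : MemLp f 2)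
    (φ : 𝓢(V, ℂ)) :
    ∫ w, φ w • (𝓕 (hf_two.toLp f) : Lp F 2 (volume : Measure V)) w = ∫ w, φ w • 𝓕 f w :=
  calc _ = ∫ v, 𝓕 φ v • hf_two.toLp f v := by
        simpa using congrArg (fun D : TemperedDistribution V F => D φ)
          (Lp.fourier_toTemperedDistribution_eq (hf_two.toLp f)).symm
    _ = ∫ v, 𝓕 φ v • f v :=
        integral_congr_ae (hf_two.coeFn_toLp.mono fun v hv => by simp only [hv])
    _ = ∫ w, φ w • 𝓕 f w := by
        simpa [SchwartzMap.fourier_coe] using!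
          VectorFourier.integral_fourierIntegral_smul_eq_flip (L := innerₗ V)
            Real.continuous_fourierChar (continuous_inner (𝕜 := ℝ)) φ.integrable hf

theorem fourier_toLp_ae_eq {f : V → F} (hf : Integrable f) (hf_two : MemLp f 2) :
    (𝓕 (hf_two.toLp f) : Lp F 2 (volume : Measure V)) =ᵐ[volume] 𝓕 f := by
  refine ae_eq_of_integral_contDiff_smul_eq
    ((Lp.memLp (𝓕 (hf_two.toLp f))).locallyIntegrable one_le_two)
    (continuous_fourier_of_integrable hf).locallyIntegrable fun g hg hgc => ?_
  have compactSupport : HasCompactSupport (Complex.ofRealCLM ∘ g) := hgc.comp_left rfl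
  exact integral_smul_fourier_toLp hf hf_two
    (compactSupport.toSchwartzMap (Complex.ofRealCLM.contDiff.comp hg))

theorem lintegral_enorm_fourier_sq {f : V → F} (hf : Integrable f) (hf_two : MemLp f 2) :
    ∫⁻ w, ‖𝓕 f w‖ₑ ^ 2 = ∫⁻ v, ‖f v‖ₑ ^ 2 := by
  rw [← eLpNorm_two_sq, ← eLpNorm_two_sq, ← eLpNorm_congr_ae (fourier_toLp_ae_eq hf hf_two),
    ← Lp.enorm_def, ← ofReal_norm, Lp.norm_fourier_eq, ofReal_norm, Lp.enorm_toLp]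

end Plancherel

theorem lintegral_comp_div {a : ℝ} (ha : 0 < a) (f : ℝ → ENNReal) :
    ∫⁻ x, f (x / a) = ENNReal.ofReal a * ∫⁻ x, f x := by
  have ha_inv : a⁻¹ ≠ 0 := inv_ne_zero ha.ne'
  calc ∫⁻ x, f (x / a) = ∫⁻ x, f x ∂(Measure.map (· * a⁻¹) volume) := by
        simp only [(measurableEmbedding_mulRight₀ ha_inv).lintegral_map, div_eq_mul_inv]
    _ = ENNReal.ofReal a * ∫⁻ x, f x := by
        rw [Real.map_volume_mul_right ha_inv, inv_inv, abs_of_pos ha, lintegral_smul_measure,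
          smul_eq_mul]

section LaplaceTransform

variable {H : Type u} [NormedAddCommGroup H] [InnerProductSpace ℂ H]
variable {T : ℝ → H →L[ℂ] H} {M : ℝ} {z : ℂ}

namespace IsBoundedC0Semigroup

theorem norm_cexp_smul_apply_le (hT : IsBoundedC0Semigroup T M) (z : ℂ) {t : ℝ} (ht : 0 ≤ t)
    (h : H) : ‖Complex.exp (-z * t) • T t h‖ ≤ Real.exp (-z.re * t) * (M * ‖h‖) := by
  rw [norm_smul, Complex.norm_exp, Complex.re_mul_ofReal, Complex.neg_re]
  gcongr
  exact hT.norm_apply_le ht h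

theorem continuousOn_cexp_smul_orbit (hT : IsBoundedC0Semigroup T M) (z : ℂ) (h : H) :
    ContinuousOn (fun t : ℝ => Complex.exp (-z * t) • T t h) (Set.Ici 0) :=
  (Continuous.continuousOn (by fun_prop)).smul (hT.continuousOn_orbit h)

theorem integrableOn_cexp_smul_orbit (hT : IsBoundedC0Semigroup T M) (hz : 0 < z.re) (h : H) :
    IntegrableOn (fun t : ℝ => Complex.exp (-z * t) • T t h) (Set.Ioi 0) :=
  ((exp_neg_integrableOn_Ioi 0 hz).mul_const (M * ‖h‖)).mono'
    (((hT.continuousOn_cexp_smul_orbit z h).mono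
      Set.Ioi_subset_Ici_self).aestronglyMeasurable measurableSet_Ioi)
    ((ae_restrict_mem measurableSet_Ioi).mono fun _ ht =>
      hT.norm_cexp_smul_apply_le z (le_of_lt ht) h)

theorem norm_integral_cexp_smul_orbit_le (hT : IsBoundedC0Semigroup T M) (hz : 0 < z.re) (h : H) :
    ‖∫ t : ℝ in Set.Ioi 0, Complex.exp (-z * t) • T t h‖ ≤ M / z.re * ‖h‖ :=
  calc _ ≤ ∫ t in Set.Ioi 0, Real.exp (-z.re * t) * (M * ‖h‖) :=
        norm_integral_le_of_norm_le ((exp_neg_integrableOn_Ioi 0 hz).mul_const _)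
          ((ae_restrict_mem measurableSet_Ioi).mono fun _ ht =>
            hT.norm_cexp_smul_apply_le z (le_of_lt ht) h)
    _ = M / z.re * ‖h‖ := by
        rw [integral_mul_const, integral_exp_mul_Ioi (neg_lt_zero.2 hz), mul_zero, Real.exp_zero,
          neg_div_neg_eq]
        ring

/-- The Laplace transform `h ↦ ∫_0^∞ e^{-zt} T(t) h dt` of a bounded semigroup, for `Re z > 0`. -/
noncomputable def laplaceTransform (hT : IsBoundedC0Semigroup T M) (hz : 0 < z.re) : H →L[ℂ] H :=
  LinearMap.mkContinuous
    { toFun h := ∫ t : ℝ in Set.Ioi 0, Complex.exp (-z * t) • T t h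
      map_add' x y := by
        rw [← integral_add (hT.integrableOn_cexp_smul_orbit hz x)
          (hT.integrableOn_cexp_smul_orbit hz y)]
        simp only [map_add, smul_add]
      map_smul' c x := by
        rw [RingHom.id_apply, ← integral_smul]
        simp only [map_smul, smul_comm c] }
    (M / z.re) (hT.norm_integral_cexp_smul_orbit_le hz)

theorem laplaceTransform_apply (hT : IsBoundedC0Semigroup T M) (hz : 0 < z.re) (h : H) :
    hT.laplaceTransform hz h = ∫ t : ℝ in Set.Ioi 0, Complex.exp (-z * t) • T t h := rfl

variable [CompleteSpace H]

theorem apply_laplaceTransform (hT : IsBoundedC0Semigroup T M) (hz : 0 < z.re) (h : H) {s : ℝ}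
    (hs : 0 ≤ s) : T s (hT.laplaceTransform hz h) = Complex.exp (z * s) •
      (hT.laplaceTransform hz h - ∫ t in (0 : ℝ)..s, Complex.exp (-z * t) • T t h) := by
  have integrable := hT.integrableOn_cexp_smul_orbit hz h
  have shift : ∫ t : ℝ in Set.Ioi s, Complex.exp (-z * t) • T t h =
      ∫ t : ℝ in Set.Ioi 0, Complex.exp (-z * (t + s : ℝ)) • T (t + s) h := by
    simpa using ((measurePreserving_add_right volume s).setIntegral_preimage_emb
      (measurableEmbedding_addRight s)
      (fun t : ℝ => Complex.exp (-z * t) • T t h) (Set.Ioi s)).symm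
  rw [laplaceTransform_apply, ← intervalIntegral.integral_Ioi_sub_Ioi integrable hs,
    sub_sub_cancel, shift, ← ContinuousLinearMap.integral_comp_comm _ integrable, ← integral_smul]
  refine setIntegral_congr_fun measurableSet_Ioi fun t ht => ?_
  rw [map_smul, smul_smul, ← Complex.exp_add, add_comm t s, hT.apply_add hs (le_of_lt ht)]
  congr 2
  push_cast
  ring

theorem hasDerivWithinAt_apply_laplaceTransform (hT : IsBoundedC0Semigroup T M) (hz : 0 < z.re)
    (h : H) : HasDerivWithinAt (fun s => T s (hT.laplaceTransform hz h))
      (z • hT.laplaceTransform hz h - h) (Set.Ici 0) 0 := by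
  have continuousOn := hT.continuousOn_cexp_smul_orbit z h
  have deriv_integral : HasDerivWithinAt
      (fun s : ℝ => ∫ t in (0 : ℝ)..s, Complex.exp (-z * t) • T t h) h (Set.Ici 0) 0 := by
    simpa [hT.apply_zero] using intervalIntegral.integral_hasDerivWithinAt_right
      (s := Set.Ici 0) (t := Set.Ioi 0) IntervalIntegrable.refl
      ((continuousOn.mono Set.Ioi_subset_Ici_self).stronglyMeasurableAtFilter_nhdsWithin
        measurableSet_Ioi 0)
      ((continuousOn 0 Set.self_mem_Ici).mono Set.Ioi_subset_Ici_self)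
  have deriv_cexp : HasDerivAt (fun s : ℝ => Complex.exp (z * s)) z 0 := by
    simpa using ((Complex.ofRealCLM.hasDerivAt (x := 0)).const_mul z).cexp
  refine HasDerivWithinAt.congr ?_ (fun s hs => hT.apply_laplaceTransform hz h hs)
    (hT.apply_laplaceTransform hz h le_rfl)
  convert deriv_cexp.hasDerivWithinAt.fun_smul
    (deriv_integral.const_sub (hT.laplaceTransform hz h)) using 1
  simp only [Complex.ofReal_zero, mul_zero, Complex.exp_zero, one_smul,
    intervalIntegral.integral_same, sub_zero]
  abel

variable {E : H →ₗ.[ℂ] H}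

theorem isResolventAt_laplaceTransform (hT : IsBoundedC0Semigroup T M) (hE : IsGeneratorOf E T)
    (hz : 0 < z.re) : IsResolventAt E z (hT.laplaceTransform hz) := by
  rw [hT.isGeneratorOf_iff] at hE
  set L := hT.laplaceTransform hz
  have mem_graph h : (L h, z • L h - h) ∈ E.graph :=
    (hE _ _).2 (hT.hasDerivWithinAt_apply_laplaceTransform hz h)
  have L_mem h : L h ∈ E.domain := E.mem_domain_of_mem_graph (mem_graph h)
  have E_L h : E ⟨L h, L_mem h⟩ = z • L h - h :=
    E.mem_graph_snd_inj (E.mem_graph _) (mem_graph h) rfl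
  refine ⟨fun h => ⟨L_mem h, by rw [E_L, sub_sub_cancel]⟩, fun x => ?_⟩
  let y : E.domain := ⟨L (z • (x : H) - E x), L_mem _⟩
  have eigen : E (y - x) = z • ((y : H) - x) := by
    rw [E.map_sub, E_L]
    module
  exact sub_eq_zero.1 (hT.eq_zero_of_eigenvector hz ((hE _ _).1 (eigen ▸ E.mem_graph (y - x))))

theorem mem_operatorResolventSet (hT : IsBoundedC0Semigroup T M) (hE : IsGeneratorOf E T)
    (hz : 0 < z.re) : z ∈ operatorResolventSet E :=
  ⟨_, hT.isResolventAt_laplaceTransform hE hz⟩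

theorem operatorResolvent_eq_laplaceTransform (hT : IsBoundedC0Semigroup T M)
    (hE : IsGeneratorOf E T) (hz : 0 < z.re) :
    operatorResolvent E z = hT.laplaceTransform hz :=
  (isResolventAt_operatorResolvent (hT.mem_operatorResolventSet hE hz)).unique
    (hT.isResolventAt_laplaceTransform hE hz)

end IsBoundedC0Semigroup

end LaplaceTransform

section AbelMeans

open FourierTransform ProbabilityTheory

variable {H : Type u} [NormedAddCommGroup H] [InnerProductSpace ℂ H]
variable {T : ℝ → H →L[ℂ] H} {E : H →ₗ.[ℂ] H} {M ε : ℝ}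

theorem lintegral_expMeasure {r : ℝ} (hr : 0 < r) (f : ℝ → ENNReal) :
    ∫⁻ t, f t ∂expMeasure r = ENNReal.ofReal r *
      ∫⁻ t in Set.Ioi 0, ENNReal.ofReal (Real.exp (-(r * t))) * f t := by
  have density (t : ℝ) : exponentialPDF r t * f t = (Set.Ici 0).indicator
      (fun t => ENNReal.ofReal r * (ENNReal.ofReal (Real.exp (-(r * t))) * f t)) t := by
    rcases le_or_gt 0 t with ht | ht
    · rw [exponentialPDF_of_nonneg ht, Set.indicator_of_mem (Set.mem_Ici.2 ht),
        ENNReal.ofReal_mul hr.le, mul_assoc]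
    · rw [exponentialPDF_of_neg ht, Set.indicator_of_notMem (Set.notMem_Ici.2 ht), zero_mul]
  calc ∫⁻ t, f t ∂expMeasure r = ∫⁻ t, exponentialPDF r t * f t :=
        lintegral_withDensity_eq_lintegral_mul_non_measurable _
          (measurable_exponentialPDFReal r).ennreal_ofReal
          (Eventually.of_forall fun _ => ENNReal.ofReal_lt_top) f
    _ = _ := by
        rw [lintegral_congr density, lintegral_indicator measurableSet_Ici,
          lintegral_const_mul' _ _ ENNReal.ofReal_ne_top, setLIntegral_congr Ioi_ae_eq_Ici]

theorem ae_expMeasure_nonneg {r : ℝ} : ∀ᵐ t ∂expMeasure r, 0 ≤ t := by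
  refine (ae_withDensity_iff (measurable_exponentialPDFReal r).ennreal_ofReal).2
    (Eventually.of_forall fun t ht => ?_)
  by_contra! h
  exact ht (exponentialPDF_of_neg h)

/-- The orbit `t ↦ e^{-εt} T(t) h` on `(0, ∞)`, extended by zero. Its Fourier transform is the
resolvent of the generator along the line `Re z = ε`. -/
noncomputable def dampedOrbit (T : ℝ → H →L[ℂ] H) (ε : ℝ) (h : H) : ℝ → H :=
  (Set.Ioi 0).indicator fun t : ℝ => Complex.exp (-ε * t) • T t h

theorem lintegral_enorm_dampedOrbit_sq (T : ℝ → H →L[ℂ] H) (hε : 0 < ε) (h : H) :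
    ENNReal.ofReal (2 * ε) * ∫⁻ t, ‖dampedOrbit T ε h t‖ₑ ^ 2 =
      ∫⁻ t, ‖T t h‖ₑ ^ 2 ∂expMeasure (2 * ε) := by
  have enorm_sq (t : ℝ) : ‖dampedOrbit T ε h t‖ₑ ^ 2 = (Set.Ioi 0).indicator
      (fun t => ENNReal.ofReal (Real.exp (-(2 * ε * t))) * ‖T t h‖ₑ ^ 2) t := by
    by_cases ht : t ∈ Set.Ioi 0
    · rw [dampedOrbit, Set.indicator_of_mem ht, Set.indicator_of_mem ht, enorm_smul, mul_pow,
        ← ofReal_norm, Complex.norm_exp, ← ENNReal.ofReal_pow (Real.exp_nonneg _),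
        ← Real.exp_nat_mul, Complex.re_mul_ofReal, Complex.neg_re, Complex.ofReal_re]
      ring_nf
    · rw [dampedOrbit, Set.indicator_of_notMem ht, Set.indicator_of_notMem ht, enorm_zero,
        zero_pow two_ne_zero]
  rw [lintegral_congr enorm_sq, lintegral_indicator measurableSet_Ioi,
    ← lintegral_expMeasure (by positivity)]

namespace IsBoundedC0Semigroup

theorem integrable_dampedOrbit (hT : IsBoundedC0Semigroup T M) (hε : 0 < ε) (h : H) :
    Integrable (dampedOrbit T ε h) :=
  (integrable_indicator_iff measurableSet_Ioi).2
    (hT.integrableOn_cexp_smul_orbit (z := ε) (by simpa using hε) h)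

theorem lintegral_enorm_orbit_sq_expMeasure_le (hT : IsBoundedC0Semigroup T M) {r : ℝ}
    (hr : 0 < r) (h : H) :
    ∫⁻ t, ‖T t h‖ₑ ^ 2 ∂expMeasure r ≤ ENNReal.ofReal (M ^ 2 * ‖h‖ ^ 2) := by
  have := isProbabilityMeasure_expMeasure hr
  rw [← mul_pow]
  exact lintegral_enorm_sq_le (ae_expMeasure_nonneg.mono fun t ht => hT.norm_apply_le ht h)

theorem memLp_dampedOrbit (hT : IsBoundedC0Semigroup T M) (hε : 0 < ε) (h : H) :
    MemLp (dampedOrbit T ε h) 2 := by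
  refine memLp_two_of_lintegral_lt_top (hT.integrable_dampedOrbit hε h).1
    (ENNReal.lt_top_of_mul_ne_top_right (a := ENNReal.ofReal (2 * ε)) ?_ ?_)
  · rw [lintegral_enorm_dampedOrbit_sq T hε]
    exact ne_top_of_le_ne_top ENNReal.ofReal_ne_top
      (hT.lintegral_enorm_orbit_sq_expMeasure_le (by positivity) h)
  · simpa using hε

variable [CompleteSpace H]

theorem operatorResolvent_eq_fourier_dampedOrbit (hT : IsBoundedC0Semigroup T M)
    (hE : IsGeneratorOf E T) (hε : 0 < ε) (h : H) (ξ : ℝ) :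
    operatorResolvent E ((ε : ℂ) + (ξ : ℂ) * Complex.I) h =
      𝓕 (dampedOrbit T ε h) (ξ / (2 * Real.pi)) := by
  have re_pos : 0 < ((ε : ℂ) + (ξ : ℂ) * Complex.I).re := by simpa using hε
  rw [hT.operatorResolvent_eq_laplaceTransform hE re_pos, laplaceTransform_apply,
    ← integral_indicator measurableSet_Ioi, Real.fourier_real_eq_integral_exp_smul]
  congr 1 with t
  by_cases ht : t ∈ Set.Ioi 0
  · rw [dampedOrbit, Set.indicator_of_mem ht, Set.indicator_of_mem ht, smul_smul,
      ← Complex.exp_add]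
    congr 2
    have := Real.pi_ne_zero
    push_cast
    field_simp
    ring
  · rw [dampedOrbit, Set.indicator_of_notMem ht, Set.indicator_of_notMem ht, smul_zero]

theorem isResolventWeight_idPMap (hT : IsBoundedC0Semigroup T M) (hE : IsGeneratorOf E T) :
    IsResolventWeight (idPMap H) E where
  dense := dense_univ
  domain_le := le_top
  measurable ε hε h := by
    simp_rw [applyOp_idPMap, hT.operatorResolvent_eq_fourier_dampedOrbit hE hε]
    exact ((continuous_fourier_of_integrable (hT.integrable_dampedOrbit hε h)).comp
      (continuous_id.div_const _)).aestronglyMeasurable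

theorem resolventMean_idPMap (hT : IsBoundedC0Semigroup T M) (hE : IsGeneratorOf E T)
    (hε : 0 < ε) (h : H) : resolventMean (idPMap H) E h ε =
      ENNReal.ofReal Real.pi * ∫⁻ t, ‖T t h‖ₑ ^ 2 ∂expMeasure (2 * ε) :=
  calc resolventMean (idPMap H) E h ε
      = ENNReal.ofReal ε * ∫⁻ ξ, ‖𝓕 (dampedOrbit T ε h) (ξ / (2 * Real.pi))‖ₑ ^ 2 := by
        simp only [resolventMean, applyOp_idPMap,
          hT.operatorResolvent_eq_fourier_dampedOrbit hE hε]
    _ = ENNReal.ofReal ε * (ENNReal.ofReal (2 * Real.pi) *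
          ∫⁻ t, ‖dampedOrbit T ε h t‖ₑ ^ 2) := by
        rw [lintegral_comp_div Real.two_pi_pos fun w => ‖𝓕 (dampedOrbit T ε h) w‖ₑ ^ 2,
          lintegral_enorm_fourier_sq (hT.integrable_dampedOrbit hε h) (hT.memLp_dampedOrbit hε h)]
    _ = ENNReal.ofReal Real.pi * ∫⁻ t, ‖T t h‖ₑ ^ 2 ∂expMeasure (2 * ε) := by
        rw [← lintegral_enorm_dampedOrbit_sq T hε, ← mul_assoc, ← mul_assoc,
          ← ENNReal.ofReal_mul hε.le, ← ENNReal.ofReal_mul Real.pi_nonneg]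
        ring_nf

theorem resolventMean_idPMap_le (hT : IsBoundedC0Semigroup T M) (hE : IsGeneratorOf E T)
    (hε : 0 < ε) (h : H) :
    resolventMean (idPMap H) E h ε ≤ ENNReal.ofReal (Real.pi * M ^ 2 * ‖h‖ ^ 2) := by
  rw [hT.resolventMean_idPMap hE hε, mul_assoc, ENNReal.ofReal_mul Real.pi_nonneg]
  gcongr
  exact hT.lintegral_enorm_orbit_sq_expMeasure_le (by positivity) h

theorem le_resolventMean_idPMap (hT : IsBoundedC0Semigroup T M) (hE : IsGeneratorOf E T)
    {m : ℝ} (hm : 0 ≤ m) {h : H} (hmT : ∀ t, 0 ≤ t → m * ‖h‖ ≤ ‖T t h‖) (hε : 0 < ε) :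
    ENNReal.ofReal (Real.pi * m ^ 2 * ‖h‖ ^ 2) ≤ resolventMean (idPMap H) E h ε := by
  have := isProbabilityMeasure_expMeasure (r := 2 * ε) (by positivity)
  rw [hT.resolventMean_idPMap hE hε, mul_assoc, ENNReal.ofReal_mul Real.pi_nonneg, ← mul_pow]
  gcongr
  exact le_lintegral_enorm_sq (by positivity) (ae_expMeasure_nonneg.mono hmT)

end IsBoundedC0Semigroup

end AbelMeans

section LimitsOfIdentityMeans

variable {H : Type u} [NormedAddCommGroup H] [InnerProductSpace ℂ H]
variable {T : ℝ → H →L[ℂ] H} {E : H →ₗ.[ℂ] H} {m M : ℝ}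

theorem IsBoundedC0Semigroup.limsup_cesaroMean_idPMap_le (hT : IsBoundedC0Semigroup T M) (h : H) :
    limsup (cesaroMean (idPMap H) T h) atTop ≤ ENNReal.ofReal (M ^ 2 * ‖h‖ ^ 2) :=
  limsup_le_of_le (by isBoundedDefault) <|
    (eventually_gt_atTop 0).mono fun _ ht => hT.cesaroMean_idPMap_le h ht

theorem le_limsup_cesaroMean_idPMap (hm : 0 ≤ m) {h : H}
    (hmT : ∀ t, 0 ≤ t → m * ‖h‖ ≤ ‖T t h‖) :
    ENNReal.ofReal (m ^ 2 * ‖h‖ ^ 2) ≤ limsup (cesaroMean (idPMap H) T h) atTop :=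
  (le_liminf_of_le (by isBoundedDefault) <|
    (eventually_gt_atTop 0).mono fun _ ht => le_cesaroMean_idPMap hm hmT ht).trans
      liminf_le_limsup

variable [CompleteSpace H]

theorem IsBoundedC0Semigroup.limsup_resolventMean_idPMap_le (hT : IsBoundedC0Semigroup T M)
    (hE : IsGeneratorOf E T) (h : H) :
    limsup (resolventMean (idPMap H) E h) (𝓝[>] 0) ≤
      ENNReal.ofReal (Real.pi * M ^ 2 * ‖h‖ ^ 2) :=
  limsup_le_of_le (by isBoundedDefault) <|
    eventually_mem_nhdsWithin.mono fun _ hε => hT.resolventMean_idPMap_le hE hε h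

theorem IsBoundedC0Semigroup.le_liminf_resolventMean_idPMap (hT : IsBoundedC0Semigroup T M)
    (hE : IsGeneratorOf E T) (hm : 0 ≤ m) {h : H} (hmT : ∀ t, 0 ≤ t → m * ‖h‖ ≤ ‖T t h‖) :
    ENNReal.ofReal (Real.pi * m ^ 2 * ‖h‖ ^ 2) ≤
      liminf (resolventMean (idPMap H) E h) (𝓝[>] 0) :=
  le_liminf_of_le (by isBoundedDefault) <|
    eventually_mem_nhdsWithin.mono fun _ hε => hT.le_resolventMean_idPMap hE hm hmT hε

end LimitsOfIdentityMeans

theorem operatorSpectrum_subset_re_nonpos_iff {H : Type u} [NormedAddCommGroup H]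
    [InnerProductSpace ℂ H] {E : H →ₗ.[ℂ] H} :
    operatorSpectrum E ⊆ {z : ℂ | z.re ≤ 0} ↔
      ∀ z : ℂ, 0 < z.re → z ∈ operatorResolventSet E := by
  rw [operatorSpectrum, Set.compl_subset_comm]
  simp only [Set.subset_def, Set.mem_compl_iff, Set.mem_ofPred_eq, not_le]

theorem mainTheorem12 {H : Type u} [NormedAddCommGroup H] [InnerProductSpace ℂ H]
    [CompleteSpace H] (E : H →ₗ.[ℂ] H) :
    List.TFAE [
      -- `E` generates a `C₀`-semigroup similar to an isometric one
      ∃ T : ℝ → H →L[ℂ] H, IsC0Semigroup T ∧ IsGeneratorOf E T ∧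
        IsSimilarToIsometricSemigroup T,
      -- `E` generates a `C₀`-semigroup with two-sided bounds on weighted Cesàro means
      ∃ T : ℝ → H →L[ℂ] H, IsC0Semigroup T ∧ IsGeneratorOf E T ∧
        ∃ (K : Type u) (_ : NormedAddCommGroup K) (_ : InnerProductSpace ℂ K)
          (_ : CompleteSpace K) (C : H →ₗ.[ℂ] K),
          IsSemigroupWeight C T ∧
          ∃ α β : ℝ, 0 < α ∧ 0 < β ∧
            ((∀ h ∈ C.domain,
                ENNReal.ofReal (α * ‖h‖ ^ 2) ≤ limsup (cesaroMean C T h) atTop ∧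
                limsup (cesaroMean C T h) atTop ≤ ENNReal.ofReal (β * ‖h‖ ^ 2)) ∨
             (∀ h ∈ C.domain,
                ENNReal.ofReal (α * ‖h‖ ^ 2) ≤ liminf (cesaroMean C T h) atTop ∧
                liminf (cesaroMean C T h) atTop ≤ ENNReal.ofReal (β * ‖h‖ ^ 2))),
      -- spectrum in the closed left half-plane and two-sided bounds on weighted resolvent means
      operatorSpectrum E ⊆ {z : ℂ | z.re ≤ 0} ∧
        ∃ (K : Type u) (_ : NormedAddCommGroup K) (_ : InnerProductSpace ℂ K)
          (_ : CompleteSpace K) (C : H →ₗ.[ℂ] K),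
          IsResolventWeight C E ∧
          ∃ α β : ℝ, 0 < α ∧ 0 < β ∧ ∀ h : H,
            limsup (resolventMean C E h) (𝓝[>] 0) ≤ ENNReal.ofReal (β * ‖h‖ ^ 2) ∧
            ENNReal.ofReal (α * ‖h‖ ^ 2) ≤ liminf (resolventMean C E h) (𝓝[>] 0)] := by
  tfae_have 1 → 2 := by
    rintro ⟨T, hT, hE, hsim⟩
    obtain ⟨m, M, hm, hM, hTM, hmT⟩ := hsim.exists_bounds hT
    exact ⟨T, hT, hE, H, _, _, inferInstance, idPMap H, hTM.isSemigroupWeight_idPMap,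
      m ^ 2, M ^ 2, by positivity, by positivity, Or.inl fun h _ =>
        ⟨le_limsup_cesaroMean_idPMap hm.le fun t ht => hmT t ht h,
          hTM.limsup_cesaroMean_idPMap_le h⟩⟩
  tfae_have 2 → 1 := by
    rintro ⟨T, hT, hE, K, _, _, _, C, hC, α, β, hα, hβ, bounds | bounds⟩
    exacts [
      ⟨T, hT, hE, isShiftInvariantLimit_limsup.isSimilarToIsometricSemigroup hT hC hα hβ bounds⟩,
      ⟨T, hT, hE, isShiftInvariantLimit_liminf.isSimilarToIsometricSemigroup hT hC hα hβ bounds⟩]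
  tfae_have 1 → 3 := by
    rintro ⟨T, hT, hE, hsim⟩
    obtain ⟨m, M, hm, hM, hTM, hmT⟩ := hsim.exists_bounds hT
    exact ⟨operatorSpectrum_subset_re_nonpos_iff.2 fun z hz => hTM.mem_operatorResolventSet hE hz,
      H, _, _, inferInstance, idPMap H, hTM.isResolventWeight_idPMap hE,
      Real.pi * m ^ 2, Real.pi * M ^ 2, by positivity, by positivity, fun h =>
        ⟨hTM.limsup_resolventMean_idPMap_le hE h,
          hTM.le_liminf_resolventMean_idPMap hE hm.le fun t ht => hmT t ht h⟩⟩
  tfae_have 3 → 1 := by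
    rintro ⟨hσ, K, _, _, _, C, hC, α, β, hα, hβ, bounds⟩
    exact hC.exists_isSimilarToIsometricSemigroup (operatorSpectrum_subset_re_nonpos_iff.1 hσ)
      hα hβ (fun h => (bounds h).1) fun h => (bounds h).2
  tfae_finish
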